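/- Let $n\ge 0$ and let $\mathcal Y_{n+1}^1=\mathrm{Conf}^{\mathbb Z_2}_{n+1}(U(1))/U(1)$, where $\mathrm{Conf}^{\mathbb Z_2}_{n+1}(U(1))$ is the space of all $(p_0,\dots,p_n)\in U(1)^{n+1}$ with $p_i\ne \pm p_j$ for $i\neq j$, and $U(1)$ acts by diagonal left multiplication. Let $[n]_0^{\pm}=\{0,\bar 0,1,\bar 1,\dots,n,\bar n\}$ with $\bar{\bar i}=i$, and put $p_{\bar i}=-p_i$. For distinct $i,j,k\in[n]_0^\pm$ the signed cyclic Heaviside function $y_{ijk}$ on $\mathcal Y_{n+1}^1$ takes the value $1$ at the class of $(p_0,\dots,p_n)$ if $p_i,p_j,p_k$ occur in this counter-clockwise cyclic order on $U(1)$, and $0$ otherwise. It is locally constant, so it defines a class $y_{ijk}\in H^0(\mathcal Y_{n+1}^1;\mathbb Z)\subseteq H^*(\mathcal Y_{n+1}^1;\mathbb Z)$. Let $\mathbb Z[y_{ijk}]$ be the polynomial ring with one variable $y_{ijk}$ for each ordered triple of distinct elements $i,j,k$ of $[n]_0^\pm$, and let $\mathcal I$ be the ideal generated by the following relations, for all indices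 in $[n]^\pm_0$ such that the indices in each occurring variable are distinct, with $i,j,k,\ell$ pairwise distinct in (iv) and (v): (i) $y_{ijk}(1-y_{ijk})=0$; (ii) $y_{ijk}=1-y_{ikj}$; (iii) $y_{\bar i jk}=y_{i\bar j\bar k}$; (iv) $y_{ijk}-y_{ij\ell}+y_{ik\ell}-y_{jk\ell}=0$; (v) $y_{ijk}y_{ik\ell}(1-y_{ij\ell})+(1-y_{ijk})(1-y_{ik\ell})y_{ij\ell}=0$. Then there is a ring isomorphism $$\mathbb Z[y_{ijk}]/\mathcal I\;\xrightarrow{\ \cong\ }\;H^*(\mathcal Y_{n+1}^1;\mathbb Z)$$ onto the singular cohomology ring which sends each variable $y_{ijk}$ to the class of the signed cyclic Heaviside function $y_{ijk}$. Moreover, for $1\le k\le n$ let $h_k=\{y_{0\bar 0k}\}\cup\{y_{0jk},\,y_{0j\bar k}: 1\le j<k\}$, and let $\mathcal N$ be the set of monomials obtained by multiplying at most one element of each of $h_1,\dots,h_n$. Then (the image of) $\mathcal N$ is a $\mathbb Z$-basis of $H^*(\mathcal Y_{n+1}^1;\mathbb Z)$. -/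

import Mathlib

noncomputable section

/-! ### The singular cohomology ring -/

/-- Singular `n`-simplices of a topological space. -/
abbrev SingularSimplex (X : Type*) [TopologicalSpace X] (n : ℕ) : Type _ :=
  C(stdSimplex ℝ (Fin (n + 1)), X)

namespace SingularSimplex

variable {X : Type*} [TopologicalSpace X] {m n : ℕ}

/-- Precomposition of a singular simplex with the affine map of standard simplices
given on the vertices by `f`. -/
def pull (σ : SingularSimplex X n) (f : Fin (m + 1) → Fin (n + 1)) : SingularSimplex X m :=
  σ.comp ⟨stdSimplex.map f, stdSimplex.continuous_map f⟩

theorem pull_pull {l : ℕ} (σ : SingularSimplex X n) (f : Fin (m + 1) → Fin (n + 1))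
    (g : Fin (l + 1) → Fin (m + 1)) : (σ.pull f).pull g = σ.pull (f ∘ g) := by
  ext x
  simp [pull, stdSimplex.map_comp_apply]

theorem pull_id (σ : SingularSimplex X n) : σ.pull id = σ := by
  ext x
  simp [pull]

/-- The `i`-th face `σ|[v₀, …, vᵢ₋₁, vᵢ₊₁, …, vₙ₊₁]`, for `i ≤ n + 1`. -/
def face (σ : SingularSimplex X (n + 1)) (i : ℕ) : SingularSimplex X n :=
  σ.pull fun j => ⟨if (j : ℕ) < i then j else j + 1, by split_ifs <;> omega⟩

/-- The segment `σ|[v_a, …, v_(a+m)]`. It is only used when `a + m ≤ n`, and then the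
minimum in its definition is the first of the two numbers. -/
def seg (σ : SingularSimplex X n) (a m : ℕ) : SingularSimplex X m :=
  σ.pull fun j => ⟨min (a + j) n, by omega⟩

theorem seg_seg (σ : SingularSimplex X n) (a m b l : ℕ) (h : b + l ≤ m) :
    (σ.seg a m).seg b l = σ.seg (a + b) l := by
  simp only [seg, pull_pull]
  congr 1
  funext j
  apply Fin.ext
  simp only [Function.comp_apply]
  omega

theorem seg_self (σ : SingularSimplex X n) : σ.seg 0 n = σ := by
  conv_rhs => rw [← pull_id σ]
  simp only [seg]
  congr 1
  funext j
  apply Fin.ext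
  simp only [id_eq]
  omega

theorem face_seg_of_le (σ : SingularSimplex X (n + 1)) (i p q : ℕ) (hi : i ≤ p)
    (h : p + q = n) : (σ.face i).seg p q = σ.seg (p + 1) q := by
  simp only [seg, face, pull_pull]
  congr 1
  funext j
  apply Fin.ext
  simp only [Function.comp_apply]
  split_ifs <;> omega

theorem face_seg_zero_of_le (σ : SingularSimplex X (n + 1)) (i p : ℕ)
    (h : p ≤ n) : (σ.face i).seg 0 p = (σ.seg 0 (p + 1)).face i := by
  simp only [seg, face, pull_pull]
  congr 1
  funext j
  apply Fin.ext
  simp only [Function.comp_apply]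
  split_ifs <;> omega

theorem face_seg_zero_of_lt (σ : SingularSimplex X (n + 1)) (i p : ℕ) (hi : p < i)
    (h : p ≤ n) : (σ.face i).seg 0 p = σ.seg 0 p := by
  simp only [seg, face, pull_pull]
  congr 1
  funext j
  apply Fin.ext
  simp only [Function.comp_apply]
  split_ifs <;> omega

theorem face_seg_of_lt (σ : SingularSimplex X (n + 1)) (i p q : ℕ)
    (h : p + q = n) : (σ.face (p + i)).seg p q = (σ.seg p (q + 1)).face i := by
  simp only [seg, face, pull_pull]
  congr 1
  funext j
  apply Fin.ext
  simp only [Function.comp_apply]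
  split_ifs <;> omega

theorem seg_zero_face_last (σ : SingularSimplex X (n + 1)) (p : ℕ) :
    (σ.seg 0 (p + 1)).face (p + 1) = σ.seg 0 p := by
  simp only [seg, face, pull_pull]
  congr 1
  funext j
  apply Fin.ext
  simp only [Function.comp_apply]
  split_ifs <;> omega

theorem seg_face_zero (σ : SingularSimplex X (n + 1)) (p q : ℕ) (h : p + q = n) :
    (σ.seg p (q + 1)).face 0 = σ.seg (p + 1) q := by
  simp only [seg, face, pull_pull]
  congr 1
  funext j
  apply Fin.ext
  simp only [Function.comp_apply]
  split_ifs <;> omega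

end SingularSimplex

/-- Inhomogeneous singular cochains: a family consisting of one `R`-valued singular
`n`-cochain for every `n`. -/
def SingularCochain (R X : Type*) [TopologicalSpace X] : Type _ :=
  ∀ n : ℕ, SingularSimplex X n → R

namespace SingularCochain

variable {R X : Type*} [TopologicalSpace X]

theorem ext' {f g : SingularCochain R X} (h : ∀ n σ, f n σ = g n σ) : f = g :=
  funext fun n => funext fun σ => h n σ

variable [CommRing R]

instance : AddCommGroup (SingularCochain R X) :=
  inferInstanceAs (AddCommGroup (∀ n : ℕ, SingularSimplex X n → R))

@[simp] theorem add_apply (f g : SingularCochain R X) (n : ℕ) (σ : SingularSimplex X n) :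
    (f + g) n σ = f n σ + g n σ := rfl

@[simp] theorem neg_apply (f : SingularCochain R X) (n : ℕ) (σ : SingularSimplex X n) :
    (-f) n σ = -f n σ := rfl

@[simp] theorem zero_apply (n : ℕ) (σ : SingularSimplex X n) :
    (0 : SingularCochain R X) n σ = 0 := rfl

/-- The `0`-cochain with the values of a function on points. -/
def ofFun (h : X → R) : SingularCochain R X
  | 0 => fun σ => h (σ (stdSimplex.vertex 0))
  | _ + 1 => fun _ => 0

instance : One (SingularCochain R X) := ⟨ofFun fun _ => 1⟩

/-- The cup product:
`(f ⌣ g)(σ) = ∑_{p + q = n} f(σ|[v₀, …, v_p]) g(σ|[v_p, …, v_n])` on an `n`-simplex `σ`. -/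
instance : Mul (SingularCochain R X) :=
  ⟨fun f g n σ => ∑ x ∈ Finset.HasAntidiagonal.antidiagonal n, f x.1 (σ.seg 0 x.1) * g x.2 (σ.seg x.1 x.2)⟩

theorem cup_apply (f g : SingularCochain R X) (n : ℕ) (σ : SingularSimplex X n) :
    (f * g) n σ =
      ∑ x ∈ Finset.HasAntidiagonal.antidiagonal n, f x.1 (σ.seg 0 x.1) * g x.2 (σ.seg x.1 x.2) := rfl

theorem one_apply_zero (σ : SingularSimplex X 0) : (1 : SingularCochain R X) 0 σ = 1 := rfl

theorem one_apply_succ (n : ℕ) (σ : SingularSimplex X (n + 1)) :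
    (1 : SingularCochain R X) (n + 1) σ = 0 := rfl

theorem one_mul' (f : SingularCochain R X) : 1 * f = f := by
  refine ext' fun n σ => ?_
  rw [cup_apply, Finset.sum_eq_single (0, n)]
  · change (1 : SingularCochain R X) 0 (σ.seg 0 0) * f n (σ.seg 0 n) = f n σ
    rw [one_apply_zero, SingularSimplex.seg_self, one_mul]
  · rintro ⟨p, q⟩ hpq hne
    cases p with
    | zero => simp_all
    | succ p => simp [one_apply_succ]
  · simp

theorem mul_one' (f : SingularCochain R X) : f * 1 = f := by
  refine ext' fun n σ => ?_
  rw [cup_apply, Finset.sum_eq_single (n, 0)]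
  · change f n (σ.seg 0 n) * (1 : SingularCochain R X) 0 (σ.seg n 0) = f n σ
    rw [one_apply_zero, SingularSimplex.seg_self, mul_one]
  · rintro ⟨p, q⟩ hpq hne
    cases q with
    | zero => simp_all
    | succ q => simp [one_apply_succ]
  · simp

theorem mul_assoc' (f g h : SingularCochain R X) : f * g * h = f * (g * h) := by
  refine ext' fun n σ => ?_
  simp only [cup_apply, Finset.sum_mul, Finset.mul_sum]
  rw [Finset.sum_sigma', Finset.sum_sigma']
  refine Finset.sum_nbij' (fun x => ⟨(x.2.1, x.2.2 + x.1.2), (x.2.2, x.1.2)⟩)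
    (fun x => ⟨(x.1.1 + x.2.1, x.2.2), (x.1.1, x.2.1)⟩) ?_ ?_ ?_ ?_ ?_
  · rintro ⟨⟨a, c⟩, ⟨p, q⟩⟩ hx
    simp only [Finset.mem_sigma, Finset.HasAntidiagonal.mem_antidiagonal] at hx ⊢
    obtain ⟨_, _⟩ := hx
    refine ⟨?_, ?_⟩
    · omega
    · trivial
  · rintro ⟨⟨a, c⟩, ⟨p, q⟩⟩ hx
    simp only [Finset.mem_sigma, Finset.HasAntidiagonal.mem_antidiagonal] at hx ⊢
    obtain ⟨_, _⟩ := hx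
    refine ⟨?_, ?_⟩
    · omega
    · trivial
  · rintro ⟨⟨a, c⟩, ⟨p, q⟩⟩ hx
    simp only [Finset.mem_sigma, Finset.HasAntidiagonal.mem_antidiagonal] at hx ⊢
    obtain ⟨_, rfl⟩ := hx
    rfl
  · rintro ⟨⟨a, c⟩, ⟨p, q⟩⟩ hx
    simp only [Finset.mem_sigma, Finset.HasAntidiagonal.mem_antidiagonal] at hx ⊢
    obtain ⟨_, rfl⟩ := hx
    rfl
  · rintro ⟨⟨a, c⟩, ⟨p, q⟩⟩ hx
    simp only [Finset.mem_sigma, Finset.HasAntidiagonal.mem_antidiagonal] at hx ⊢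
    obtain ⟨h1, rfl⟩ := hx
    rw [SingularSimplex.seg_seg _ _ _ _ _ (by omega), SingularSimplex.seg_seg _ _ _ _ _ (by omega),
      SingularSimplex.seg_seg _ _ _ _ _ (by omega), SingularSimplex.seg_seg _ _ _ _ _ (by omega)]
    simp only [zero_add, add_zero, mul_assoc]

/-- The ring of singular cochains under the cup product. -/
instance : Ring (SingularCochain R X) :=
  { (inferInstance : AddCommGroup (SingularCochain R X)) with
    mul := (· * ·)
    one := 1
    one_mul := one_mul'
    mul_one := mul_one'
    mul_assoc := mul_assoc'
    left_distrib := fun f g h => ext' fun n σ => by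
      simp [cup_apply, mul_add, Finset.sum_add_distrib]
    right_distrib := fun f g h => ext' fun n σ => by
      simp [cup_apply, add_mul, Finset.sum_add_distrib]
    zero_mul := fun f => ext' fun n σ => by simp [cup_apply]
    mul_zero := fun f => ext' fun n σ => by simp [cup_apply] }

/-- The coboundary: `(δ f)(σ) = ∑ᵢ (-1)ⁱ f(σ|[v₀, …, v̂ᵢ, …, vₙ₊₁])`. -/
def coboundary (f : SingularCochain R X) : SingularCochain R X
  | 0 => fun _ => 0
  | n + 1 => fun σ => ∑ i ∈ Finset.range (n + 2), (-1) ^ i * f n (σ.face i)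

theorem coboundary_zero (f : SingularCochain R X) (σ : SingularSimplex X 0) :
    coboundary f 0 σ = 0 := rfl

theorem coboundary_succ (f : SingularCochain R X) (n : ℕ) (σ : SingularSimplex X (n + 1)) :
    coboundary f (n + 1) σ = ∑ i ∈ Finset.range (n + 2), (-1) ^ i * f n (σ.face i) := rfl

theorem coboundary_map_zero : coboundary (0 : SingularCochain R X) = 0 :=
  ext' fun n σ => by
    cases n with
    | zero => rfl
    | succ n =>
      rw [coboundary_succ]
      exact Finset.sum_eq_zero fun i _ => mul_zero _

theorem coboundary_map_add (f g : SingularCochain R X) :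
    coboundary (f + g) = coboundary f + coboundary g :=
  ext' fun n σ => by
    cases n with
    | zero => exact (add_zero (0 : R)).symm
    | succ n => simp only [coboundary_succ, add_apply, mul_add, Finset.sum_add_distrib]

theorem coboundary_map_neg (f : SingularCochain R X) : coboundary (-f) = -coboundary f :=
  ext' fun n σ => by
    cases n with
    | zero => exact (neg_zero (G := R)).symm
    | succ n => simp only [coboundary_succ, neg_apply, mul_neg, Finset.sum_neg_distrib]

/-- The degree involution `f ↦ (-1)^deg f`. -/
def degSign (f : SingularCochain R X) : SingularCochain R X := fun n σ => (-1) ^ n * f n σ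

theorem degSign_degSign (f : SingularCochain R X) : degSign (degSign f) = f :=
  ext' fun n σ => by simp [degSign, ← mul_assoc, ← mul_pow]

theorem coboundary_degSign (f : SingularCochain R X) :
    coboundary (degSign f) = -degSign (coboundary f) := by
  refine ext' fun n σ => ?_
  cases n with
  | zero => simp [coboundary_zero, degSign]
  | succ n =>
    simp only [coboundary_succ, degSign, neg_apply, Finset.mul_sum, ← Finset.sum_neg_distrib]
    refine Finset.sum_congr rfl fun i _ => ?_
    ring

/-- The Leibniz rule. -/
theorem coboundary_mul (f g : SingularCochain R X) :
    coboundary (f * g) = coboundary f * g + degSign f * coboundary g := by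
  refine ext' fun n σ => ?_
  cases n with
  | zero => simp [coboundary_zero, cup_apply]
  | succ n =>
    rw [add_apply, cup_apply, cup_apply, Finset.Nat.antidiagonal_succ, Finset.sum_cons,
      ← Finset.Nat.antidiagonal_succ, Finset.Nat.antidiagonal_succ', Finset.sum_cons]
    simp only [coboundary_zero, zero_mul, mul_zero, zero_add, Finset.sum_map,
      Function.Embedding.prodMap, Function.Embedding.coeFn_mk, Prod.map_fst, Prod.map_snd,
      Function.Embedding.refl_apply, Nat.succ_eq_add_one]
    rw [coboundary_succ, ← Finset.sum_add_distrib]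
    simp only [cup_apply, Finset.mul_sum]
    rw [Finset.sum_comm]
    refine Finset.sum_congr rfl ?_
    rintro ⟨p, q⟩ hpq
    simp only [Finset.HasAntidiagonal.mem_antidiagonal] at hpq
    simp only [coboundary_succ, degSign]
    rw [show n + 2 = (p + 1) + (q + 1) by omega, Finset.sum_range_add, Finset.sum_range_succ
      (n := p + 1), Finset.sum_range_succ' (n := q + 1),
      SingularSimplex.seg_zero_face_last,
      SingularSimplex.seg_face_zero _ _ _ hpq]
    have h1 : ∀ i ∈ Finset.range (p + 1), (-1 : R) ^ i *
        (f p ((σ.face i).seg 0 p) * g q ((σ.face i).seg p q)) =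
        (-1) ^ i * f p ((σ.seg 0 (p + 1)).face i) * g q (σ.seg (p + 1) q) := by
      intro i hi
      rw [Finset.mem_range] at hi
      rw [SingularSimplex.face_seg_zero_of_le _ _ _ (by omega),
        SingularSimplex.face_seg_of_le _ _ _ _ (by omega) hpq, mul_assoc]
    have h2 : ∀ i ∈ Finset.range (q + 1), (-1 : R) ^ (p + 1 + i) *
        (f p ((σ.face (p + 1 + i)).seg 0 p) * g q ((σ.face (p + 1 + i)).seg p q)) =
        (-1) ^ p * f p (σ.seg 0 p) * ((-1) ^ (i + 1) * g q ((σ.seg p (q + 1)).face (i + 1))) := by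
      intro i hi
      rw [SingularSimplex.face_seg_zero_of_lt _ _ _ (by omega) (by omega),
        show p + 1 + i = p + (i + 1) by omega, SingularSimplex.face_seg_of_lt _ _ _ _ hpq, pow_add]
      ring
    rw [Finset.sum_congr rfl h1, Finset.sum_congr rfl h2, ← Finset.sum_mul, ← Finset.mul_sum]
    change _ = (_ + _) * g q (σ.seg (p + 1) q) + (-1) ^ p * f p (σ.seg 0 p) * (_ + _)
    ring

/-- A cochain with only finitely many nonzero components, that is, an element of the
direct sum of the groups of singular `n`-cochains. -/
def Bounded (f : SingularCochain R X) : Prop := ∃ N : ℕ, ∀ n, N < n → ∀ σ, f n σ = 0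

theorem bounded_ofFun (h : X → R) : (ofFun h : SingularCochain R X).Bounded :=
  ⟨0, fun n hn σ => by cases n with
    | zero => omega
    | succ n => rfl⟩

theorem Bounded.add {f g : SingularCochain R X} (hf : f.Bounded) (hg : g.Bounded) :
    (f + g).Bounded := by
  obtain ⟨M, hM⟩ := hf
  obtain ⟨N, hN⟩ := hg
  exact ⟨M + N, fun n hn σ => by rw [add_apply, hM n (by omega), hN n (by omega), add_zero]⟩

theorem Bounded.neg {f : SingularCochain R X} (hf : f.Bounded) : (-f).Bounded := by
  obtain ⟨M, hM⟩ := hf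
  exact ⟨M, fun n hn σ => by rw [neg_apply, hM n hn, neg_zero]⟩

theorem Bounded.mul {f g : SingularCochain R X} (hf : f.Bounded) (hg : g.Bounded) :
    (f * g).Bounded := by
  obtain ⟨M, hM⟩ := hf
  obtain ⟨N, hN⟩ := hg
  refine ⟨M + N, fun n hn σ => ?_⟩
  rw [cup_apply]
  refine Finset.sum_eq_zero ?_
  rintro ⟨p, q⟩ hpq
  simp only [Finset.HasAntidiagonal.mem_antidiagonal] at hpq
  by_cases hp : M < p
  · rw [hM p hp, zero_mul]
  · rw [hN q (by omega), mul_zero]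

theorem Bounded.degSign {f : SingularCochain R X} (hf : f.Bounded) :
    (degSign f).Bounded := by
  obtain ⟨M, hM⟩ := hf
  exact ⟨M, fun n hn σ => by simp [SingularCochain.degSign, hM n hn]⟩

variable (R X)

/-- The ring of singular cocycles. -/
def cocycles : Subring (SingularCochain R X) where
  carrier := {f | f.Bounded ∧ coboundary f = 0}
  zero_mem' := ⟨⟨0, fun _ _ _ => rfl⟩, coboundary_map_zero⟩
  one_mem' := ⟨bounded_ofFun _, ext' fun n σ => by
    cases n with
    | zero => rfl
    | succ n =>
      rw [coboundary_succ]
      cases n with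
      | zero => simp [Finset.sum_range_succ, one_apply_zero]
      | succ n => simp [one_apply_succ]⟩
  add_mem' := fun ha hb => ⟨ha.1.add hb.1, by rw [coboundary_map_add, ha.2, hb.2, add_zero]⟩
  neg_mem' := fun ha => ⟨ha.1.neg, by rw [coboundary_map_neg, ha.2, neg_zero]⟩
  mul_mem' := fun ha hb => ⟨ha.1.mul hb.1, by
    rw [coboundary_mul, ha.2, hb.2, zero_mul, mul_zero, add_zero]⟩

/-- The ideal of coboundaries in the ring of cocycles. -/
def coboundaries : Ideal (cocycles R X) where
  carrier := {z | ∃ g : SingularCochain R X, g.Bounded ∧ coboundary g = z}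
  zero_mem' := ⟨0, ⟨0, fun _ _ _ => rfl⟩, coboundary_map_zero⟩
  add_mem' := by
    rintro a b ⟨g, hg, hga⟩ ⟨h, hh, hhb⟩
    exact ⟨g + h, hg.add hh, by rw [coboundary_map_add, hga, hhb, Subring.coe_add]⟩
  smul_mem' := by
    rintro z a ⟨g, hg, hga⟩
    refine ⟨degSign z.1 * g, z.2.1.degSign.mul hg, ?_⟩
    have h0 : degSign (0 : SingularCochain R X) = 0 := ext' fun n σ => by simp [degSign]
    rw [coboundary_mul, coboundary_degSign, z.2.2, h0, neg_zero, zero_mul, zero_add,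
      degSign_degSign, hga, smul_eq_mul, Subring.coe_mul]

instance : (coboundaries R X).IsTwoSided where
  mul_mem_of_left {a} z := by
    rintro ⟨g, hg, hga⟩
    refine ⟨g * z.1, hg.mul z.2.1, ?_⟩
    rw [coboundary_mul, z.2.2, mul_zero, add_zero, hga, Subring.coe_mul]

end SingularCochain

/-- The singular cohomology ring `H^*(X; R) = ⨁ₖ H^k(X; R)`, with the cup product. -/
def SingularCohomology (R X : Type*) [CommRing R] [TopologicalSpace X] : Type _ :=
  SingularCochain.cocycles R X ⧸ SingularCochain.coboundaries R X

namespace SingularCohomology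

variable (R X : Type*) [CommRing R] [TopologicalSpace X]

instance : Ring (SingularCohomology R X) :=
  inferInstanceAs (Ring (SingularCochain.cocycles R X ⧸ SingularCochain.coboundaries R X))

variable {R X}

/-- The cohomology class of a cocycle. -/
def mk : SingularCochain.cocycles R X →+* SingularCohomology R X :=
  Ideal.Quotient.mk (SingularCochain.coboundaries R X)

theorem ofFun_mem_cocycles (h : LocallyConstant X R) :
    (SingularCochain.ofFun h : SingularCochain R X) ∈ SingularCochain.cocycles R X := by
  refine ⟨SingularCochain.bounded_ofFun _, SingularCochain.ext' fun n σ => ?_⟩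
  cases n with
  | zero => rfl
  | succ n =>
    rw [SingularCochain.coboundary_succ]
    cases n with
    | succ n => simp [SingularCochain.ofFun]
    | zero =>
      have hc : IsLocallyConstant (h ∘ σ) := h.isLocallyConstant.comp_continuous σ.continuous
      have := hc.apply_eq_of_preconnectedSpace
      simp only [Function.comp_apply] at this
      simp only [SingularCochain.ofFun, SingularSimplex.face, SingularSimplex.pull,
        Finset.sum_range_succ, Finset.sum_range_zero, ContinuousMap.comp_apply]
      rw [this _ (stdSimplex.vertex 0), this _ (stdSimplex.vertex 0)]
      simp

/-- The class in `H^0(X; R)` of a locally constant function. -/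
def ofLocallyConstant (h : LocallyConstant X R) : SingularCohomology R X :=
  mk ⟨SingularCochain.ofFun h, ofFun_mem_cocycles h⟩

end SingularCohomology

/-! ### The space `Y` -/

namespace TypeB

/-- The orbit configuration space of `n + 1` points `p₀, …, pₙ` of the circle `U(1)` for the
antipodal action of `ℤ/2`: the antipodal orbits `{pᵢ, -pᵢ}` are pairwise disjoint. -/
def OrbitConf (n : ℕ) : Type :=
  {p : Fin (n + 1) → Circle // ∀ i j, i ≠ j → p i ≠ p j ∧ p i ≠ -p j}

instance (n : ℕ) : TopologicalSpace (OrbitConf n) :=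
  inferInstanceAs (TopologicalSpace {p : Fin (n + 1) → Circle // ∀ i j, i ≠ j → p i ≠ p j ∧ p i ≠ -p j})

/-- The diagonal action of `U(1)` by left multiplication. -/
instance (n : ℕ) : MulAction Circle (OrbitConf n) where
  smul g p := ⟨fun i => g * p.1 i, fun i j hij => by
    have h := p.2 i j hij
    exact ⟨fun e => h.1 (mul_left_cancel e),
      fun e => h.2 (mul_left_cancel (e.trans (mul_neg g (p.1 j)).symm))⟩⟩
  one_smul p := Subtype.ext (funext fun i => one_mul (p.1 i))
  mul_smul g h p := Subtype.ext (funext fun i => mul_assoc g h (p.1 i))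

/-- The quotient space `Y = Conf_{n+1}^{ℤ/2}(U(1)) / U(1)`. -/
abbrev Y (n : ℕ) : Type := MulAction.orbitRel.Quotient Circle (OrbitConf n)

/-- The index set `{0, 0̄, 1, 1̄, …, n, n̄}`: `(i, false)` stands for `i`
and `(i, true)` for `ī`. -/
abbrev SignedIndex (n : ℕ) : Type := Fin (n + 1) × Bool

/-- The unbarred index `i`. -/
abbrev pos {n : ℕ} (i : Fin (n + 1)) : SignedIndex n := (i, false)

/-- The barred index `ī`. -/
abbrev neg {n : ℕ} (i : Fin (n + 1)) : SignedIndex n := (i, true)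

/-- The involution `i ↦ ī` of the index set. -/
def bar {n : ℕ} (i : SignedIndex n) : SignedIndex n := (i.1, !i.2)

theorem bar_bar {n : ℕ} (i : SignedIndex n) : bar (bar i) = i := by
  simp [bar]

theorem ne_bar {n : ℕ} {i j : SignedIndex n} (h : bar i ≠ j) : i ≠ bar j :=
  fun e => h (by rw [e, bar_bar])

theorem bar_ne_bar {n : ℕ} {i j : SignedIndex n} (h : i ≠ j) : bar i ≠ bar j :=
  fun e => h (by rw [← bar_bar i, e, bar_bar])

/-- The point `p_i` of the arrangement `C(p)`, where `p_ī = -p_i`. -/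
def OrbitConf.point {n : ℕ} (p : OrbitConf n) (i : SignedIndex n) : Circle :=
  if i.2 then -p.1 i.1 else p.1 i.1

/-- The points `p, q, r` of the circle are distinct and are met in this order when one goes
counter-clockwise around the circle once, starting at `p`. -/
def IsCCW (p q r : Circle) : Prop :=
  ∃ a b c : ℝ, a < b ∧ b < c ∧ c < a + 2 * Real.pi ∧
    Circle.exp a = p ∧ Circle.exp b = q ∧ Circle.exp c = r

theorem IsCCW.smul {p q r : Circle} (h : IsCCW p q r) (g : Circle) :
    IsCCW (g * p) (g * q) (g * r) := by
  obtain ⟨a, b, c, hab, hbc, hca, rfl, rfl, rfl⟩ := h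
  obtain ⟨t, rfl⟩ := Circle.exp_surjective g
  exact ⟨t + a, t + b, t + c, by linarith, by linarith, by linarith,
    Circle.exp_add _ _, Circle.exp_add _ _, Circle.exp_add _ _⟩

theorem isCCW_smul_iff {p q r : Circle} (g : Circle) :
    IsCCW (g * p) (g * q) (g * r) ↔ IsCCW p q r :=
  ⟨fun h => by simpa using h.smul g⁻¹, fun h => h.smul g⟩

theorem exists_lift (a : ℝ) (q : Circle) (h : Circle.exp a ≠ q) :
    ∃ b, a < b ∧ b < a + 2 * Real.pi ∧ Circle.exp b = q := by
  obtain ⟨t, rfl⟩ := Circle.exp_surjective q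
  have h2 : (0 : ℝ) < 2 * Real.pi := Real.two_pi_pos
  have h3 := toIcoMod_mem_Ico h2 a t
  have h4 : Circle.exp (toIcoMod h2 a t) = Circle.exp t := by
    rw [toIcoMod, Circle.exp_eq_exp]
    exact ⟨-toIcoDiv h2 a t, by rw [zsmul_eq_mul]; push_cast; ring⟩
  refine ⟨toIcoMod h2 a t, lt_of_le_of_ne h3.1 fun e => h ?_, h3.2, h4⟩
  rw [← h4, ← e]

theorem isCCW_or {p q r : Circle} (hpq : p ≠ q) (hpr : p ≠ r) (hqr : q ≠ r) :
    IsCCW p q r ∨ IsCCW p r q := by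
  obtain ⟨a, rfl⟩ := Circle.exp_surjective p
  obtain ⟨b, hb1, hb2, rfl⟩ := exists_lift a q hpq
  obtain ⟨c, hc1, hc2, rfl⟩ := exists_lift a r hpr
  rcases lt_trichotomy b c with h | rfl | h
  · exact Or.inl ⟨a, b, c, hb1, h, hc2, rfl, rfl, rfl⟩
  · exact absurd rfl hqr
  · exact Or.inr ⟨a, c, b, hc1, h, hb2, rfl, rfl, rfl⟩

theorem lift_unique {a b c : ℝ} (hab : a < b) (hb : b < a + 2 * Real.pi) (hac : a < c)
    (hc : c < a + 2 * Real.pi) (h : Circle.exp b = Circle.exp c) : b = c := by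
  obtain ⟨m, hm⟩ := Circle.exp_eq_exp.1 h
  have hp := Real.pi_pos
  have h1 : (m : ℝ) < 1 := by
    by_contra! hcon
    nlinarith
  have h2 : (-1 : ℝ) < m := by
    by_contra! hcon
    nlinarith
  have h3 : m = 0 := by
    have h1' : m < 1 := by exact_mod_cast h1
    have h2' : -1 < m := by exact_mod_cast h2
    omega
  simpa [h3] using hm

theorem IsCCW.not_swap {p q r : Circle} (h : IsCCW p q r) : ¬IsCCW p r q := by
  obtain ⟨a, b, c, hab, hbc, hca, rfl, rfl, rfl⟩ := h
  rintro ⟨a', c', b', hac', hcb', hba', ha, hc, hb⟩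
  obtain ⟨m, hm⟩ := Circle.exp_eq_exp.1 ha
  have e : ∀ t : ℝ, Circle.exp (t - m * (2 * Real.pi)) = Circle.exp t := fun t =>
    Circle.exp_eq_exp.2 ⟨-m, by push_cast; ring⟩
  have h1 := lift_unique (b := b' - m * (2 * Real.pi)) (c := b) (a := a) (by linarith)
    (by linarith) hab (by linarith) (by rw [e, hb])
  have h2 := lift_unique (b := c' - m * (2 * Real.pi)) (c := c) (a := a) (by linarith)
    (by linarith) (by linarith) hca (by rw [e, hc])
  linarith

theorem isOpen_isCCW : IsOpen {t : Circle × Circle × Circle | IsCCW t.1 t.2.1 t.2.2} := by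
  have ho : IsOpenMap Circle.exp := isLocalHomeomorph_circleExp.isOpenMap
  have h3 := ho.prodMap (ho.prodMap ho)
  have hU : IsOpen {x : ℝ × ℝ × ℝ | x.1 < x.2.1 ∧ x.2.1 < x.2.2 ∧
      x.2.2 < x.1 + 2 * Real.pi} := by
    have h1 : Continuous fun x : ℝ × ℝ × ℝ => x.1 := by fun_prop
    have h2 : Continuous fun x : ℝ × ℝ × ℝ => x.2.1 := by fun_prop
    have h4 : Continuous fun x : ℝ × ℝ × ℝ => x.2.2 := by fun_prop
    exact (isOpen_lt h1 h2).inter ((isOpen_lt h2 h4).inter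
      (isOpen_lt h4 (h1.add continuous_const)))
  convert h3 _ hU using 1
  ext ⟨p, q, r⟩
  simp only [IsCCW, Set.mem_ofPred_eq, Set.mem_image, Prod.exists, Prod.map_apply, Prod.mk.injEq]
  constructor
  · rintro ⟨a, b, c, h1, h2, h3, h4⟩
    exact ⟨a, b, c, ⟨h1, h2, h3⟩, h4⟩
  · rintro ⟨a, b, c, ⟨h1, h2, h3⟩, h4⟩
    exact ⟨a, b, c, h1, h2, h3, h4⟩

theorem continuous_point {n : ℕ} (i : SignedIndex n) :
    Continuous fun p : OrbitConf n => p.point i := by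
  have h : Continuous fun p : OrbitConf n => p.1 i.1 :=
    (continuous_apply i.1).comp continuous_subtype_val
  unfold OrbitConf.point
  split_ifs
  · exact h.neg
  · exact h

theorem circle_ne_neg (z : Circle) : z ≠ -z := by
  intro h
  have h1 : (z : ℂ) = -(z : ℂ) := congrArg Subtype.val h
  exact z.coe_ne_zero (by linear_combination h1 / 2)

theorem point_ne {n : ℕ} (p : OrbitConf n) {i j : SignedIndex n} (h : i ≠ j) :
    p.point i ≠ p.point j := by
  obtain ⟨i, s⟩ := i
  obtain ⟨j, t⟩ := j
  by_cases hij : i = j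
  · subst hij
    have := circle_ne_neg (p.1 i)
    cases s <;> cases t
    · exact absurd rfl h
    · simpa [OrbitConf.point] using this
    · simpa [OrbitConf.point] using this.symm
    · exact absurd rfl h
  · have h1 := p.2 i j hij
    have h2 : -p.1 i ≠ p.1 j := fun e => h1.2 (by rw [← e, neg_neg])
    have h3 : -p.1 i ≠ -p.1 j := fun e => h1.1 (neg_injective e)
    cases s <;> cases t <;> simp [OrbitConf.point, h1.1, h1.2, h2, h3]

theorem point_smul {n : ℕ} (g : Circle) (p : OrbitConf n) (i : SignedIndex n) :
    (g • p).point i = g * p.point i := by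
  unfold OrbitConf.point
  split_ifs
  · exact (mul_neg _ _).symm
  · rfl

open Classical in
/-- The signed cyclic Heaviside function `y_ijk` on the space `Y`: it is `1` at the class of `p`
if `p_i < p_j < p_k` counter-clockwise in `C(p)`, and `0` otherwise. -/
def heavisideFun {n : ℕ} (i j k : SignedIndex n) : Y n → ℤ :=
  Quotient.lift (fun p : OrbitConf n => if IsCCW (p.point i) (p.point j) (p.point k) then 1 else 0)
    (by
      rintro _ p ⟨g, rfl⟩
      simp only [point_smul, isCCW_smul_iff])

theorem isOpen_ccw {n : ℕ} (i j k : SignedIndex n) :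
    IsOpen {p : OrbitConf n | IsCCW (p.point i) (p.point j) (p.point k)} :=
  isOpen_isCCW.preimage
    ((continuous_point i).prodMk ((continuous_point j).prodMk (continuous_point k)))

theorem isLocallyConstant_heavisideFun {n : ℕ} {i j k : SignedIndex n} (hij : i ≠ j) (hik : i ≠ k)
    (hjk : j ≠ k) : IsLocallyConstant (heavisideFun i j k) := by
  classical
  intro s
  rw [← isQuotientMap_quotient_mk'.isOpen_preimage]
  have h : IsLocallyConstant fun p : OrbitConf n =>
      if IsCCW (p.point i) (p.point j) (p.point k) then (1 : ℤ) else 0 := by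
    rw [IsLocallyConstant.iff_exists_open]
    intro p
    by_cases hp : IsCCW (p.point i) (p.point j) (p.point k)
    · exact ⟨_, isOpen_ccw i j k, hp, fun q hq => (if_pos hq).trans (if_pos hp).symm⟩
    · have hp' := (isCCW_or (point_ne p hij) (point_ne p hik) (point_ne p hjk)).resolve_left hp
      exact ⟨_, isOpen_ccw i k j, hp', fun q hq =>
        (if_neg (IsCCW.not_swap hq)).trans (if_neg hp).symm⟩
  exact h s

/-- The signed cyclic Heaviside function `y_ijk` as an element of `H^*(Y; ℤ)`. -/
def heaviside {n : ℕ} (i j k : SignedIndex n) (hij : i ≠ j) (hik : i ≠ k) (hjk : j ≠ k) :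
    SingularCohomology ℤ (Y n) :=
  SingularCohomology.ofLocallyConstant
    ⟨heavisideFun i j k, isLocallyConstant_heavisideFun hij hik hjk⟩

/-! ### The presentation -/

/-- Triples of distinct elements of the index set. -/
abbrev Triple (n : ℕ) : Type :=
  {t : SignedIndex n × SignedIndex n × SignedIndex n //
    t.1 ≠ t.2.1 ∧ t.1 ≠ t.2.2 ∧ t.2.1 ≠ t.2.2}

/-- The polynomial ring `ℤ[y_ijk]` with one variable for each triple of distinct indices. -/
abbrev HeavisidePoly (n : ℕ) : Type := MvPolynomial (Triple n) ℤ

/-- The variable `y_ijk` of the polynomial ring. -/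
def y {n : ℕ} (i j k : SignedIndex n) (hij : i ≠ j) (hik : i ≠ k) (hjk : j ≠ k) :
    HeavisidePoly n :=
  MvPolynomial.X ⟨(i, j, k), hij, hik, hjk⟩

/-- The five families of relations, written as polynomials that are to vanish. -/
inductive Relation (n : ℕ) : HeavisidePoly n → Prop
  /-- `y_ijk (1 - y_ijk) = 0` -/
  | idem (i j k : SignedIndex n) (hij : i ≠ j) (hik : i ≠ k) (hjk : j ≠ k) :
      Relation n (y i j k hij hik hjk * (1 - y i j k hij hik hjk))
  /-- `y_ijk = 1 - y_ikj` -/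
  | swap (i j k : SignedIndex n) (hij : i ≠ j) (hik : i ≠ k) (hjk : j ≠ k) :
      Relation n (y i j k hij hik hjk - (1 - y i k j hik hij hjk.symm))
  /-- `y_ījk = y_ij̄k̄` -/
  | antipode (i j k : SignedIndex n) (hij : bar i ≠ j) (hik : bar i ≠ k) (hjk : j ≠ k) :
      Relation n (y (bar i) j k hij hik hjk -
        y i (bar j) (bar k) (ne_bar hij) (ne_bar hik) (bar_ne_bar hjk))
  /-- `y_ijk - y_ijl + y_ikl - y_jkl = 0` -/
  | alternating (i j k l : SignedIndex n) (hij : i ≠ j) (hik : i ≠ k) (hil : i ≠ l)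
      (hjk : j ≠ k) (hjl : j ≠ l) (hkl : k ≠ l) :
      Relation n (y i j k hij hik hjk - y i j l hij hil hjl + y i k l hik hil hkl
        - y j k l hjk hjl hkl)
  /-- `y_ijk y_ikl (1 - y_ijl) + (1 - y_ijk) (1 - y_ikl) y_ijl = 0` -/
  | transitive (i j k l : SignedIndex n) (hij : i ≠ j) (hik : i ≠ k) (hil : i ≠ l)
      (hjk : j ≠ k) (hjl : j ≠ l) (hkl : k ≠ l) :
      Relation n (y i j k hij hik hjk * y i k l hik hil hkl * (1 - y i j l hij hil hjl) +
        (1 - y i j k hij hik hjk) * (1 - y i k l hik hil hkl) * y i j l hij hil hjl)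

/-- The ideal generated by the five families of relations. -/
def relationIdeal (n : ℕ) : Ideal (HeavisidePoly n) := Ideal.span {f | Relation n f}

/-- The hand `h_k = {y_00̄k} ∪ {y_0jk, y_0jk̄ : 0 < j < k}`, for `0 < k ≤ n`. -/
def hand {n : ℕ} (k : Fin (n + 1)) : Set (HeavisidePoly n) :=
  {f | (∃ h₁ h₂ h₃, f = y (pos 0) (neg 0) (pos k) h₁ h₂ h₃) ∨
    ∃ j : Fin (n + 1), 0 < j ∧ j < k ∧
      ((∃ h₁ h₂ h₃, f = y (pos 0) (pos j) (pos k) h₁ h₂ h₃) ∨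
        ∃ h₁ h₂ h₃, f = y (pos 0) (pos j) (neg k) h₁ h₂ h₃)}

/-- The set `N` of monomials obtained by multiplying at most one finger of each of the
hands `h_1, …, h_n`. -/
def handMonomials (n : ℕ) : Set (HeavisidePoly n) :=
  {f | ∃ c : Fin n → HeavisidePoly n, (∀ k, c k = 1 ∨ c k ∈ hand k.succ) ∧ f = ∏ k, c k}

end TypeB

end

/-!
The theorem compares three copies of one ring, the ring of integral functions on a finite set of
`2 ^ n * n!` signed cyclic orders.

*Topology.* After a rotation `p₀ = 1`, and then `p_k = exp (i (θ_k + π ε_k))` with a sign `ε_k` and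
an angle `θ_k` in `[0, π)`; the angles are distinct. A component of `Y n` is given by the signs and
the order of the angles, and moving every angle along a straight line to a position that depends
only on its rank contracts the component (`TypeB.contraction`). Coning off singular simplices along
such a homotopy kills the cohomology in positive degrees, and in degree `0` it leaves the locally
constant functions (`SingularCohomology.equivOfContraction`).

*Algebra.* The generators of `ℤ[y_ijk] / I` are idempotent, so the quotient is spanned by one
idempotent for each `0`-`1` assignment to the variables. An assignment that violates some relation
gives one of the relations the value `±1`, and this kills its idempotent. Hence a polynomial lies
in `I` as soon as it vanishes on the set of solutions of the relations
(`TypeB.SolutionSet.mem_relationIdeal_iff`), and the quotient is the ring of functions on that set.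

*Combinatorics.* A solution is a linear order on the indices other than `0`, compatible with the
antipode. A function that depends only on the indices up to `k` telescopes over the places that the
index `k` passes when it moves counter-clockwise from `0`; this expresses it through `1` and the
fingers of the hand `h_k`, with coefficients depending only on the indices up to `k - 1`
(`TypeB.SolutionSet.eq_add_sum_cut`). So the hand monomials span the functions on the solutions
(`TypeB.SolutionSet.span_fingerMonomial`).

*Counting.* There are at most `2 ^ n * n!` hand monomials, and the configurations with prescribed
signs and prescribed order of the angles give `2 ^ n * n!` distinct solutions
(`TypeB.injective_solution_chartOfPerm`). As the monomials span a free module whose rank is the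
number of solutions, both numbers are equal. Therefore the monomials form a basis, and every
solution is realized by exactly one component of `Y n`.
-/

noncomputable section

open Topology

/-! ### Cohomology of a space with contractible components -/

/-- The cone parametrization `[0, 1] × Δⁿ → Δⁿ⁺¹`, `(s, u) ↦ (1 - s) v₀ + s u`, where `Δⁿ` is
embedded as the face opposite to the vertex `v₀`. -/
def coneParam (n : ℕ) (q : unitInterval × stdSimplex ℝ (Fin (n + 1))) :
    stdSimplex ℝ (Fin (n + 2)) :=
  ⟨Fin.cons (1 - (q.1 : ℝ)) fun j => (q.1 : ℝ) * q.2 j, by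
    refine ⟨fun i => ?_, ?_⟩
    · refine Fin.cases ?_ (fun j => ?_) i
      · simpa using q.1.2.2
      · rw [Fin.cons_succ]
        exact mul_nonneg q.1.2.1 (q.2.2.1 j)
    · have h : ∑ j, q.2 j = 1 := q.2.2.2
      rw [Fin.sum_univ_succ]
      simp only [Fin.cons_zero, Fin.cons_succ]
      rw [← Finset.mul_sum, h]
      ring⟩

theorem coneParam_zero {n : ℕ} (q : unitInterval × stdSimplex ℝ (Fin (n + 1))) :
    coneParam n q 0 = 1 - (q.1 : ℝ) := rfl

theorem coneParam_succ {n : ℕ} (q : unitInterval × stdSimplex ℝ (Fin (n + 1))) (j : Fin (n + 1)) :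
    coneParam n q j.succ = q.1 * q.2 j := rfl

theorem continuous_coneParam (n : ℕ) : Continuous (coneParam n) := by
  refine Continuous.subtype_mk (continuous_pi fun i => ?_) _
  have h (j : Fin (n + 1)) :
      Continuous fun q : unitInterval × stdSimplex ℝ (Fin (n + 1)) => q.2 j :=
    (continuous_apply j).comp (continuous_subtype_val.comp continuous_snd)
  refine Fin.cases ?_ (fun j => ?_) i
  · simp only [Fin.cons_zero]
    fun_prop
  · simp only [Fin.cons_succ]
    exact (continuous_subtype_val.comp continuous_fst).mul (h j)

theorem surjective_coneParam (n : ℕ) : Function.Surjective (coneParam n) := by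
  intro x
  have hsum : x 0 + ∑ j : Fin (n + 1), x j.succ = 1 := by
    rw [← Fin.sum_univ_succ]
    exact x.2.2
  have h0 (i) : 0 ≤ x i := x.2.1 i
  have hs : 0 ≤ ∑ j : Fin (n + 1), x j.succ := Finset.sum_nonneg fun j _ => h0 _
  by_cases hx : x 0 = 1
  · refine ⟨(0, stdSimplex.vertex 0), stdSimplex.ext (funext fun i => ?_)⟩
    have hz : ∑ j : Fin (n + 1), x j.succ = 0 := by linarith
    rw [Finset.sum_eq_zero_iff_of_nonneg fun j _ => h0 _] at hz
    refine Fin.cases ?_ (fun j => ?_) i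
    · rw [coneParam_zero, hx]
      simp
    · rw [coneParam_succ, hz j (Finset.mem_univ j)]
      simp
  · have hne : 1 - x 0 ≠ 0 := sub_ne_zero.2 (Ne.symm hx)
    have hpos : 0 < 1 - x 0 := lt_of_le_of_ne (by linarith) hne.symm
    refine ⟨(⟨1 - x 0, hpos.le, by linarith [h0 0]⟩,
      ⟨fun j => x j.succ / (1 - x 0), fun j => div_nonneg (h0 _) hpos.le, ?_⟩),
      stdSimplex.ext (funext fun i => ?_)⟩
    · rw [← Finset.sum_div, div_eq_one_iff_eq hne]
      linarith
    · refine Fin.cases ?_ (fun j => ?_) i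
      · rw [coneParam_zero]
        simp
      · rw [coneParam_succ]
        exact mul_div_cancel₀ _ hne

/-- A continuous surjection from a compact space to a Hausdorff space is a quotient map; this is
what makes cones over singular simplices continuous at the apex. -/
theorem isQuotientMap_coneParam (n : ℕ) : IsQuotientMap (coneParam n) :=
  (continuous_coneParam n).isClosedMap.isQuotientMap (continuous_coneParam n)
    (surjective_coneParam n)

/-- The cone parametrization is natural in the simplex. -/
theorem map_coneParam {m n : ℕ} (f : Fin (m + 1) → Fin (n + 1)) (s : unitInterval)
    (u : stdSimplex ℝ (Fin (m + 1))) :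
    stdSimplex.map (Fin.cons 0 (Fin.succ ∘ f) : Fin (m + 2) → Fin (n + 2)) (coneParam m (s, u)) =
      coneParam n (s, stdSimplex.map f u) := by
  refine stdSimplex.ext (funext fun i => ?_)
  rw [stdSimplex.map_coe, FunOnFinite.linearMap_apply_apply, Finset.sum_filter, Fin.sum_univ_succ]
  refine Fin.cases ?_ (fun j => ?_) i
  · simp [coneParam_zero, Fin.succ_ne_zero]
  · simp [coneParam_succ, FunOnFinite.linearMap_apply_apply, Finset.sum_filter, Finset.mul_sum,
      (Fin.succ_ne_zero _).symm]

theorem map_succ_eq_coneParam {n : ℕ} (u : stdSimplex ℝ (Fin (n + 1))) :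
    stdSimplex.map Fin.succ u = coneParam n (1, u) := by
  refine stdSimplex.ext (funext fun i => ?_)
  rw [stdSimplex.map_coe, FunOnFinite.linearMap_apply_apply, Finset.sum_filter]
  refine Fin.cases ?_ (fun j => ?_) i
  · simp [coneParam_zero, Fin.succ_ne_zero]
  · simp [coneParam_succ]

namespace SingularSimplex

variable {X : Type*} [TopologicalSpace X]

/-- The constant singular `0`-simplex at a point. -/
def const (x : X) : SingularSimplex X 0 := ContinuousMap.const _ x

theorem const_vertex (σ : SingularSimplex X 0) : const (σ (stdSimplex.vertex 0)) = σ := by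
  ext x
  exact congrArg σ (Subsingleton.elim _ _)

/-- The homotopy is constant on the bottom `{0} × Δⁿ`, because a simplex is connected, so that it
descends to the cone. -/
theorem exists_cone {H : unitInterval × X → X} (hH : Continuous H)
    (h0 : IsLocallyConstant fun x => H (0, x)) {n : ℕ} (σ : SingularSimplex X n) :
    ∃ τ : SingularSimplex X (n + 1), ∀ q, τ (coneParam n q) = H (q.1, σ q.2) := by
  let g : C(unitInterval × stdSimplex ℝ (Fin (n + 1)), X) :=
    ⟨fun q => H (q.1, σ q.2), by fun_prop⟩
  have hg : Function.FactorsThrough g (coneParam n) := by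
    rintro ⟨s, u⟩ ⟨t, v⟩ h
    have hst : s = t := by
      have := DFunLike.congr_fun h 0
      rw [coneParam_zero, coneParam_zero] at this
      exact Subtype.ext (by linarith)
    subst hst
    by_cases hs : s = 0
    · subst hs
      exact (h0.comp_continuous σ.continuous).apply_eq_of_preconnectedSpace u v
    · have huv : u = v := stdSimplex.ext (funext fun j => by
        have := DFunLike.congr_fun h j.succ
        rw [coneParam_succ, coneParam_succ] at this
        exact mul_left_cancel₀ (fun e => hs (Subtype.ext e)) this)
      rw [huv]
  exact ⟨(isQuotientMap_coneParam n).lift (f := ⟨_, continuous_coneParam n⟩) g hg, fun q =>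
    DFunLike.congr_fun ((isQuotientMap_coneParam n).lift_comp
      (f := ⟨_, continuous_coneParam n⟩) g hg) q⟩

/-- The cone over a singular simplex `σ` for a contraction `H` of the components: it runs from
`H (0, ·)` at the vertex `v₀` to `σ` on the opposite face. -/
def cone {H : unitInterval × X → X} (hH : Continuous H)
    (h0 : IsLocallyConstant fun x => H (0, x)) {n : ℕ} (σ : SingularSimplex X n) :
    SingularSimplex X (n + 1) :=
  (exists_cone hH h0 σ).choose

variable {H : unitInterval × X → X} (hH : Continuous H) (h0 : IsLocallyConstant fun x => H (0, x))

theorem cone_coneParam {n : ℕ} (σ : SingularSimplex X n) (q) :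
    cone hH h0 σ (coneParam n q) = H (q.1, σ q.2) :=
  (exists_cone hH h0 σ).choose_spec q

theorem cone_pull {m n : ℕ} (σ : SingularSimplex X n) (f : Fin (m + 1) → Fin (n + 1)) :
    (cone hH h0 σ).pull (Fin.cons 0 (Fin.succ ∘ f)) = cone hH h0 (σ.pull f) := by
  refine ContinuousMap.ext fun x => ?_
  obtain ⟨⟨s, u⟩, rfl⟩ := surjective_coneParam m x
  rw [cone_coneParam]
  simp only [pull, ContinuousMap.comp_apply, ContinuousMap.coe_mk]
  rw [map_coneParam, cone_coneParam]

theorem cone_face_succ {n : ℕ} (σ : SingularSimplex X (n + 1)) (i : ℕ) :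
    (cone hH h0 σ).face (i + 1) = cone hH h0 (σ.face i) := by
  rw [face, face, ← cone_pull]
  congr 1
  funext j
  refine Fin.cases ?_ (fun k => ?_) j
  · simp
  · apply Fin.ext
    simp only [Fin.val_succ, Fin.cons_succ, Function.comp_apply]
    split_ifs <;> omega

theorem cone_face_zero (h1 : ∀ x, H (1, x) = x) {n : ℕ} (σ : SingularSimplex X n) :
    (cone hH h0 σ).face 0 = σ := by
  refine ContinuousMap.ext fun x => ?_
  have : (fun j : Fin (n + 1) => (⟨if (j : ℕ) < 0 then j else j + 1, by
      split_ifs <;> omega⟩ : Fin (n + 2))) = Fin.succ := by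
    funext j
    apply Fin.ext
    simp
  simp only [face, pull, ContinuousMap.comp_apply, ContinuousMap.coe_mk]
  rw [this, map_succ_eq_coneParam, cone_coneParam, h1]

/-- The cone over a point is the path traced by that point, and its start is `H (0, x)`. -/
theorem cone_const_face_one (x : X) : (cone hH h0 (const x)).face 1 = const (H (0, x)) := by
  refine ContinuousMap.ext fun u => ?_
  have hu : stdSimplex.map (fun j : Fin 1 => (⟨if (j : ℕ) < 1 then j else j + 1, by
      split_ifs <;> omega⟩ : Fin 2)) u = coneParam 0 (0, u) := by
    rw [Subsingleton.elim u (stdSimplex.vertex 0), stdSimplex.map_vertex]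
    refine stdSimplex.ext (funext fun i => ?_)
    refine Fin.cases ?_ (fun j => ?_) i
    · rw [coneParam_zero]
      simp
    · rw [coneParam_succ]
      simp
  simp only [face, pull, ContinuousMap.comp_apply, ContinuousMap.coe_mk]
  rw [hu, cone_coneParam]
  rfl

end SingularSimplex

namespace SingularCochain

open SingularSimplex

variable {R X : Type*} [CommRing R] [TopologicalSpace X]

theorem ofFun_const (h : X → R) (x : X) : (ofFun h : SingularCochain R X) 0 (const x) = h x := rfl

theorem ofFun_mul (h k : X → R) :
    (ofFun (h * k) : SingularCochain R X) = ofFun h * ofFun k := by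
  refine ext' fun n σ => ?_
  rw [cup_apply]
  cases n with
  | zero =>
    rw [Finset.HasAntidiagonal.antidiagonal_zero, Finset.sum_singleton, SingularSimplex.seg_self]
    rfl
  | succ n =>
    refine (Finset.sum_eq_zero ?_).symm
    rintro ⟨_ | p, _ | q⟩ hpq
    · simp at hpq
    all_goals simp [ofFun]

theorem ofFun_add (h k : X → R) :
    (ofFun (h + k) : SingularCochain R X) = ofFun h + ofFun k :=
  ext' fun n σ => by cases n <;> simp [ofFun]

variable {H : unitInterval × X → X} (hH : Continuous H) (h0 : IsLocallyConstant fun x => H (0, x))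

/-- The cochain whose value on a simplex is the value of `f` on the cone over that simplex. -/
def compCone (f : SingularCochain R X) : SingularCochain R X :=
  fun n σ => f (n + 1) (cone hH h0 σ)

/-- The path from `H (0, x)` to `x` shows that the degree `0` part of a cocycle takes the same value
at both points. -/
theorem apply_const_eq_of_coboundary_eq_zero (hH : Continuous H)
    (h0 : IsLocallyConstant fun x => H (0, x)) (h1 : ∀ x, H (1, x) = x)
    {f : SingularCochain R X} (hf : coboundary f = 0)
    (x : X) : f 0 (const x) = f 0 (const (H (0, x))) := by
  have := congrFun (congrFun hf 1) (cone hH h0 (const x))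
  rw [coboundary_succ, zero_apply] at this
  simp only [Finset.sum_range_succ, Finset.sum_range_zero, pow_zero, pow_one, one_mul, zero_add,
    cone_face_zero hH h0 h1, cone_const_face_one hH h0] at this
  linear_combination this

/-- Evaluation on cones is a contracting homotopy of the cochain complex in positive degrees. -/
theorem coboundary_compCone (h1 : ∀ x, H (1, x) = x) {f : SingularCochain R X}
    (hf : coboundary f = 0) :
    coboundary (compCone hH h0 f) = f - ofFun fun x => f 0 (const x) := by
  refine ext' fun n σ => ?_
  rw [sub_eq_add_neg, add_apply, neg_apply]
  cases n with
  | zero =>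
    rw [coboundary_zero]
    conv_rhs => rw [← const_vertex σ, ofFun_const]
    ring
  | succ n =>
    have := congrFun (congrFun hf (n + 2)) (cone hH h0 σ)
    rw [coboundary_succ, zero_apply, Finset.sum_range_succ', cone_face_zero hH h0 h1] at this
    simp only [cone_face_succ hH h0, pow_succ, mul_neg, mul_one, neg_mul,
      Finset.sum_neg_distrib] at this
    rw [coboundary_succ]
    simp only [ofFun, compCone]
    linear_combination -this

end SingularCochain

namespace SingularCohomology

open SingularSimplex SingularCochain

variable {R X : Type*} [CommRing R] [TopologicalSpace X]

/-- The ring homomorphism from locally constant functions to the cohomology ring, onto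
`H⁰(X; R)`. -/
def ofLocallyConstantHom : LocallyConstant X R →+* SingularCohomology R X where
  toFun := ofLocallyConstant
  map_one' := rfl
  map_mul' h k := (congrArg mk (Subtype.ext (ofFun_mul h k))).trans (map_mul mk _ _)
  map_zero' := (congrArg mk (Subtype.ext (ext' fun n σ => by cases n <;> rfl))).trans (map_zero mk)
  map_add' h k := (congrArg mk (Subtype.ext (ofFun_add h k))).trans (map_add mk _ _)

theorem mk_eq_mk_iff {f g : cocycles R X} :
    mk f = mk g ↔ ∃ b : SingularCochain R X, b.Bounded ∧ coboundary b = f - g :=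
  Ideal.Quotient.eq

theorem injective_ofLocallyConstantHom :
    Function.Injective (ofLocallyConstantHom : LocallyConstant X R →+* _) := by
  intro h k hhk
  obtain ⟨b, -, hb⟩ := mk_eq_mk_iff.1 hhk
  refine LocallyConstant.ext fun x => ?_
  have := congrFun (congrFun hb 0) (const x)
  exact (sub_eq_zero.1 this.symm)

theorem surjective_ofLocallyConstantHom {H : unitInterval × X → X} (hH : Continuous H)
    (h0 : IsLocallyConstant fun x => H (0, x)) (h1 : ∀ x, H (1, x) = x) :
    Function.Surjective (ofLocallyConstantHom : LocallyConstant X R →+* _) := by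
  intro z
  obtain ⟨⟨f, ⟨N, hN⟩, hf⟩, rfl⟩ := Ideal.Quotient.mk_surjective z
  have hc : IsLocallyConstant fun x => f 0 (const x) := by
    have := h0.comp fun x => f 0 (const x)
    rwa [show ((fun x => f 0 (const x)) ∘ fun x => H (0, x)) = fun x => f 0 (const x) from
      funext fun x => (apply_const_eq_of_coboundary_eq_zero hH h0 h1 hf x).symm] at this
  -- a bound for the degrees of `f` also bounds those of the cochain of its values on cones
  refine ⟨⟨_, hc⟩, (mk_eq_mk_iff.2 ⟨_, ⟨N, fun n hn σ => ?_⟩,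
    coboundary_compCone hH h0 h1 hf⟩).symm⟩
  exact hN _ (by omega) _

/-- If a homotopy contracts every component of `X` to a point, then the cohomology of `X` is the
ring of locally constant functions. -/
def equivOfContraction {H : unitInterval × X → X} (hH : Continuous H)
    (h0 : IsLocallyConstant fun x => H (0, x)) (h1 : ∀ x, H (1, x) = x) :
    LocallyConstant X R ≃+* SingularCohomology R X :=
  RingEquiv.ofBijective ofLocallyConstantHom
    ⟨injective_ofLocallyConstantHom, surjective_ofLocallyConstantHom hH h0 h1⟩

end SingularCohomology

/-! ### Quotients of polynomial rings by idempotent variables -/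

section Idempotents

variable {T : Type*} [Fintype T]

/-- An ideal of an integral polynomial ring that makes every variable idempotent contains every
polynomial vanishing on its zero set, provided that at each point of the cube `{0, 1}ᵀ` off the
zero set some member of the ideal takes the value `±1`. The quotient is spanned by the orthogonal
idempotents `∏_{t ∈ S} X_t ∏_{t ∉ S} (1 - X_t)`, one for each vertex of the cube; a polynomial acts
on such an idempotent through its value at the vertex. -/
theorem mem_ideal_of_forall_eval_eq_zero (J : Ideal (MvPolynomial T ℤ))
    (hJ : ∀ t, MvPolynomial.X t * (1 - MvPolynomial.X t) ∈ J)
    (hunit : ∀ w : T → ℤ, (∀ t, w t = 0 ∨ w t = 1) → (∃ r ∈ J, MvPolynomial.eval w r ≠ 0) →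
      ∃ r ∈ J, IsUnit (MvPolynomial.eval w r))
    (P : MvPolynomial T ℤ)
    (hP : ∀ w : T → ℤ, (∀ r ∈ J, MvPolynomial.eval w r = 0) → MvPolynomial.eval w P = 0) :
    P ∈ J := by
  classical
  let a (t : T) : MvPolynomial T ℤ ⧸ J := Ideal.Quotient.mk J (MvPolynomial.X t)
  have ha (t : T) : a t * (1 - a t) = 0 := Ideal.Quotient.eq_zero_iff_mem.2 (hJ t)
  -- `e S` is the idempotent of the vertex `w S`
  let e (S : Finset T) : MvPolynomial T ℤ ⧸ J := (∏ t ∈ S, a t) * ∏ t ∈ Finset.univ \ S, (1 - a t)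
  let w (S : Finset T) (t : T) : ℤ := if t ∈ S then 1 else 0
  have hsum : ∑ S ∈ (Finset.univ : Finset T).powerset, e S = 1 := by
    rw [← Finset.prod_add]
    simp
  have hae (S : Finset T) (t : T) : a t * e S = (w S t : ℤ) * e S := by
    by_cases ht : t ∈ S
    · simp only [e, w, if_pos ht, Int.cast_one, one_mul]
      rw [← Finset.mul_prod_erase S a ht]
      linear_combination (-(∏ x ∈ S.erase t, a x) * ∏ t ∈ Finset.univ \ S, (1 - a t)) * ha t
    · have ht' : t ∈ Finset.univ \ S := by simpa using ht
      simp only [e, w, if_neg ht, Int.cast_zero, zero_mul]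
      rw [← Finset.mul_prod_erase _ (fun x => 1 - a x) ht']
      linear_combination
        ((∏ x ∈ S, a x) * ∏ x ∈ (Finset.univ \ S).erase t, (1 - a x)) * ha t
  have hmul (S : Finset T) (Q : MvPolynomial T ℤ) :
      Ideal.Quotient.mk J Q * e S = (MvPolynomial.eval (w S) Q : ℤ) * e S := by
    induction Q using MvPolynomial.induction_on with
    | C z => simp
    | add p q hp hq => simp only [map_add, add_mul, hp, hq, Int.cast_add]
    | mul_X p t hp =>
      rw [map_mul, mul_assoc, show Ideal.Quotient.mk J (MvPolynomial.X t) = a t from rfl, hae,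
        mul_left_comm, hp, map_mul, MvPolynomial.eval_X]
      push_cast
      ring
  rw [← Ideal.Quotient.eq_zero_iff_mem, ← mul_one (Ideal.Quotient.mk J P), ← hsum, Finset.mul_sum]
  refine Finset.sum_eq_zero fun S _ => ?_
  by_cases hS : ∀ r ∈ J, MvPolynomial.eval (w S) r = 0
  · rw [hmul, hP _ hS, Int.cast_zero, zero_mul]
  · push Not at hS
    obtain ⟨r, hr, hu⟩ := hunit (w S) (fun t => by simp only [w]; split_ifs <;> simp) hS
    have h0 := hmul S r
    rw [Ideal.Quotient.eq_zero_iff_mem.2 hr, zero_mul] at h0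
    have he : e S = 0 := by
      obtain ⟨u, hu⟩ := hu
      have : ((↑u⁻¹ : ℤ) : MvPolynomial T ℤ ⧸ J) * ((u : ℤ) * e S) = e S := by
        rw [← mul_assoc, ← Int.cast_mul, Units.inv_mul, Int.cast_one, one_mul]
      rw [← this, hu, ← h0, mul_zero]
    rw [he, mul_zero]

end Idempotents

namespace TypeB

/-! ### Integral points of the relations -/

/-- The integral solutions of the five families of relations. Their coordinates are `0` or `1`,
and they are the signed cyclic orders of the index set. -/
def SolutionSet (n : ℕ) : Type :=
  {w : Triple n → ℤ // ∀ r, Relation n r → MvPolynomial.eval w r = 0}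

namespace SolutionSet

variable {n : ℕ}

/-- Evaluation of polynomials at the solutions of the relations. -/
def ev : HeavisidePoly n →+* (SolutionSet n → ℤ) :=
  RingHom.pi fun w => MvPolynomial.eval w.1

theorem ev_apply (P : HeavisidePoly n) (w : SolutionSet n) : ev P w = MvPolynomial.eval w.1 P := rfl

theorem ext_triple {w w' : SolutionSet n} (h : ∀ t, w.1 t = w'.1 t) : w = w' :=
  Subtype.ext (funext h)

theorem eval_eq_zero_of_mem (w : SolutionSet n) {P : HeavisidePoly n}
    (hP : P ∈ relationIdeal n) : MvPolynomial.eval w.1 P = 0 := by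
  have : relationIdeal n ≤ RingHom.ker (MvPolynomial.eval w.1) :=
    Ideal.span_le.2 fun r hr => w.2 r hr
  exact this hP

/-- The alternating sum can take the values `±2` at a point of the cube; it does so only where the
transitivity relation with the same indices takes the value `1`. -/
theorem exists_isUnit_eval {w : Triple n → ℤ} (hw : ∀ t, w t = 0 ∨ w t = 1) {r : HeavisidePoly n}
    (hr : Relation n r) (h : MvPolynomial.eval w r ≠ 0) :
    ∃ r', Relation n r' ∧ IsUnit (MvPolynomial.eval w r') := by
  cases hr with
  | idem i j k hij hik hjk =>
    rcases hw ⟨(i, j, k), hij, hik, hjk⟩ with h1 | h1 <;> simp [y, h1] at h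
  | swap i j k hij hik hjk =>
    refine ⟨_, Relation.swap i j k hij hik hjk, ?_⟩
    rcases hw ⟨(i, j, k), hij, hik, hjk⟩ with h1 | h1 <;>
    rcases hw ⟨(i, k, j), hik, hij, hjk.symm⟩ with h2 | h2 <;> simp [y, h1, h2] at h ⊢
  | antipode i j k hij hik hjk =>
    refine ⟨_, Relation.antipode i j k hij hik hjk, ?_⟩
    rcases hw ⟨(bar i, j, k), hij, hik, hjk⟩ with h1 | h1 <;>
    rcases hw ⟨(i, bar j, bar k), ne_bar hij, ne_bar hik, bar_ne_bar hjk⟩ with h2 | h2 <;>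
    simp [y, h1, h2] at h ⊢
  | alternating i j k l hij hik hil hjk hjl hkl =>
    have ht := Relation.transitive i j k l hij hik hil hjk hjl hkl
    have ha := Relation.alternating i j k l hij hik hil hjk hjl hkl
    rcases hw ⟨(i, j, k), hij, hik, hjk⟩ with h1 | h1 <;>
    rcases hw ⟨(i, j, l), hij, hil, hjl⟩ with h2 | h2 <;>
    rcases hw ⟨(i, k, l), hik, hil, hkl⟩ with h3 | h3 <;>
    rcases hw ⟨(j, k, l), hjk, hjl, hkl⟩ with h4 | h4 <;>
    first
      | refine ⟨_, ha, ?_⟩; simp [y, h1, h2, h3, h4]; done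
      | refine ⟨_, ht, ?_⟩; simp [y, h1, h2, h3]; done
      | simp [y, h1, h2, h3, h4] at h
  | transitive i j k l hij hik hil hjk hjl hkl =>
    refine ⟨_, Relation.transitive i j k l hij hik hil hjk hjl hkl, ?_⟩
    rcases hw ⟨(i, j, k), hij, hik, hjk⟩ with h1 | h1 <;>
    rcases hw ⟨(i, j, l), hij, hil, hjl⟩ with h2 | h2 <;>
    rcases hw ⟨(i, k, l), hik, hil, hkl⟩ with h3 | h3 <;> simp [y, h1, h2, h3] at h ⊢

/-- The relations cut out a reduced ring: a polynomial that vanishes at all solutions lies in the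
ideal of relations. -/
theorem mem_relationIdeal_iff (P : HeavisidePoly n) : P ∈ relationIdeal n ↔ ev P = 0 := by
  classical
  refine ⟨fun hP => funext fun w => eval_eq_zero_of_mem w hP, fun hP => ?_⟩
  refine mem_ideal_of_forall_eval_eq_zero _ ?_ ?_ P fun w hw => ?_
  · rintro ⟨⟨i, j, k⟩, hij, hik, hjk⟩
    exact Ideal.subset_span (Relation.idem i j k hij hik hjk)
  · rintro w hw ⟨r, hr, hne⟩
    have : ∃ r, Relation n r ∧ MvPolynomial.eval w r ≠ 0 := by
      by_contra! hcon
      have hle : relationIdeal n ≤ RingHom.ker (MvPolynomial.eval w) :=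
        Ideal.span_le.2 fun r hr => hcon r hr
      exact hne (hle hr)
    obtain ⟨r, hr, hne⟩ := this
    obtain ⟨r', hr', hu⟩ := exists_isUnit_eval hw hr hne
    exact ⟨r', Ideal.subset_span hr', hu⟩
  · exact congrFun hP ⟨w, fun r hr => hw r (Ideal.subset_span hr)⟩

theorem eq_zero_or_eq_one (w : SolutionSet n) (t : Triple n) : w.1 t = 0 ∨ w.1 t = 1 := by
  obtain ⟨⟨i, j, k⟩, hij, hik, hjk⟩ := t
  have := w.2 _ (Relation.idem i j k hij hik hjk)
  simp only [y, map_mul, map_sub, map_one, MvPolynomial.eval_X, mul_eq_zero] at this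
  exact this.imp_right fun h => by linarith

instance : Finite (SolutionSet n) := by
  have : Function.Injective fun (w : SolutionSet n) (t : Triple n) => decide (w.1 t = 1) := by
    intro w w' h
    refine ext_triple fun t => ?_
    have ht := congrFun h t
    simp only [decide_eq_decide] at ht
    rcases w.eq_zero_or_eq_one t with h1 | h1 <;> rcases w'.eq_zero_or_eq_one t with h2 | h2 <;>
      simp_all
  exact Finite.of_injective _ this

/-! ### The linear order cut out of a signed cyclic order at the index `0` -/

/-- The coordinate `y_0ab` of a solution, extended by `0` to degenerate triples. It is `1` if `a`
precedes `b` in the linear order obtained by cutting the signed cyclic order at `0`. -/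
def cut (w : SolutionSet n) (a b : SignedIndex n) : ℤ :=
  if h : pos 0 ≠ a ∧ pos 0 ≠ b ∧ a ≠ b then w.1 ⟨(pos 0, a, b), h⟩ else 0

theorem cut_eq (w : SolutionSet n) {a b : SignedIndex n} (ha : pos 0 ≠ a) (hb : pos 0 ≠ b)
    (hab : a ≠ b) : w.cut a b = w.1 ⟨(pos 0, a, b), ha, hb, hab⟩ :=
  dif_pos ⟨ha, hb, hab⟩

theorem cut_eq_zero_or (w : SolutionSet n) (a b : SignedIndex n) :
    w.cut a b = 0 ∨ w.cut a b = 1 := by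
  unfold cut
  split_ifs
  · exact w.eq_zero_or_eq_one _
  · exact Or.inl rfl

theorem ev_y (w : SolutionSet n) {a b : SignedIndex n} (ha : pos 0 ≠ a) (hb : pos 0 ≠ b)
    (hab : a ≠ b) : ev (y (pos 0) a b ha hb hab) w = w.cut a b := by
  rw [cut_eq w ha hb hab, ev_apply, y, MvPolynomial.eval_X]

theorem cut_swap (w : SolutionSet n) {a b : SignedIndex n} (ha : pos 0 ≠ a) (hb : pos 0 ≠ b)
    (hab : a ≠ b) : w.cut a b = 1 - w.cut b a := by
  have := w.2 _ (Relation.swap (pos 0) a b ha hb hab)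
  simp only [y, map_sub, map_one, MvPolynomial.eval_X] at this
  rw [cut_eq w ha hb hab, cut_eq w hb ha hab.symm]
  linarith

theorem cut_trans (w : SolutionSet n) {a b c : SignedIndex n} (ha : pos 0 ≠ a) (hb : pos 0 ≠ b)
    (hc : pos 0 ≠ c) (hab : a ≠ b) (hac : a ≠ c) (hbc : b ≠ c) (h1 : w.cut a b = 1)
    (h2 : w.cut b c = 1) : w.cut a c = 1 := by
  have := w.2 _ (Relation.transitive (pos 0) a b c ha hb hc hab hac hbc)
  simp only [y, map_sub, map_one, MvPolynomial.eval_X, map_add, map_mul] at this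
  rw [← cut_eq w ha hb hab, ← cut_eq w ha hc hac, ← cut_eq w hb hc hbc, h1, h2] at this
  linarith

/-- All coordinates are determined by those of the form `y_0ab`. -/
theorem apply_eq (w : SolutionSet n) {a b c : SignedIndex n} (ha : pos 0 ≠ a) (hb : pos 0 ≠ b)
    (hc : pos 0 ≠ c) (hab : a ≠ b) (hac : a ≠ c) (hbc : b ≠ c) :
    w.1 ⟨(a, b, c), hab, hac, hbc⟩ = w.cut a b - w.cut a c + w.cut b c := by
  have := w.2 _ (Relation.alternating (pos 0) a b c ha hb hc hab hac hbc)
  simp only [y, map_sub, MvPolynomial.eval_X, map_add] at this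
  rw [cut_eq w ha hb hab, cut_eq w ha hc hac, cut_eq w hb hc hbc]
  linarith

theorem swap_apply (w : SolutionSet n) {a b c : SignedIndex n} (hab : a ≠ b) (hac : a ≠ c)
    (hbc : b ≠ c) :
    w.1 ⟨(a, b, c), hab, hac, hbc⟩ = 1 - w.1 ⟨(a, c, b), hac, hab, hbc.symm⟩ := by
  have := w.2 _ (Relation.swap a b c hab hac hbc)
  simp only [y, map_sub, map_one, MvPolynomial.eval_X] at this
  linarith

/-- Exchanging the first two indices has the same effect on a coordinate as exchanging the last
two. The relations give this only in the presence of a fourth index. -/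
theorem swap_apply_left (w : SolutionSet n) {a b c d : SignedIndex n} (hab : a ≠ b) (hac : a ≠ c)
    (hbc : b ≠ c) (hda : d ≠ a) (hdb : d ≠ b) (hdc : d ≠ c) :
    w.1 ⟨(a, b, c), hab, hac, hbc⟩ = 1 - w.1 ⟨(b, a, c), hab.symm, hbc, hac⟩ := by
  -- adding the alternating relations for `d, a, b, c` and for `d, b, a, c` leaves these two terms
  have h1 := w.2 _ (Relation.alternating d a b c hda hdb hdc hab hac hbc)
  have h2 := w.2 _ (Relation.alternating d b a c hdb hda hdc hab.symm hbc hac)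
  have h3 := w.swap_apply hda hdb hab
  simp only [y, map_sub, MvPolynomial.eval_X, map_add] at h1 h2
  linarith

/-- Two distinct indices other than `0` lie among at least four indices, since the index set is
stable under the antipode. -/
theorem exists_fourth {a b : SignedIndex n} (ha : pos 0 ≠ a) (hb : pos 0 ≠ b) (hab : a ≠ b) :
    ∃ d, d ≠ a ∧ d ≠ b ∧ d ≠ pos 0 := by
  by_cases h : bar a = b ∨ bar a = pos 0
  · by_cases h' : a = neg 0
    · subst h'
      refine ⟨bar b, ?_, ?_, ?_⟩
      · intro e; apply hb; rw [← bar_bar b, e]; rfl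
      · intro e; exact absurd (congrArg Prod.snd e) (by simp [bar])
      · intro e; apply hab; rw [← bar_bar b, e]; rfl
    · refine ⟨neg 0, Ne.symm h', ?_, ?_⟩
      · rintro rfl
        rcases h with h | h
        · apply ha; rw [← bar_bar a, h]; rfl
        · exact h' (by rw [← bar_bar a, h]; rfl)
      · simp [pos, neg]
  · push Not at h
    refine ⟨bar a, ?_, h.1, h.2⟩
    intro e; exact absurd (congrArg Prod.snd e) (by simp [bar])

/-- A solution is determined by the linear order that it cuts out at the index `0`. -/
theorem ext_cut {w w' : SolutionSet n} (h : ∀ a b, pos 0 ≠ a → pos 0 ≠ b → a ≠ b →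
    w.cut a b = w'.cut a b) : w = w' := by
  refine ext_triple ?_
  rintro ⟨⟨a, b, c⟩, hab, hac, hbc⟩
  dsimp only at hab hac hbc
  by_cases ha : pos 0 = a
  · subst ha
    have := h b c hab hac hbc
    rwa [cut_eq _ hab hac hbc, cut_eq _ hab hac hbc] at this
  by_cases hb : pos 0 = b
  · subst hb
    obtain ⟨d, h1, h2, h3⟩ := exists_fourth ha hbc hac
    have := h a c ha hbc hac
    rw [cut_eq _ ha hbc hac, cut_eq _ ha hbc hac] at this
    rw [swap_apply_left w hab hac hbc h1 h3 h2, swap_apply_left w' hab hac hbc h1 h3 h2, this]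
  by_cases hc : pos 0 = c
  · subst hc
    obtain ⟨d, h1, h2, h3⟩ := exists_fourth ha hb hab
    have := h a b ha hb hab
    rw [cut_eq _ ha hb hab, cut_eq _ ha hb hab] at this
    rw [swap_apply w hab hac hbc, swap_apply w' hab hac hbc,
      swap_apply_left w hac hab hbc.symm h1 h3 h2,
      swap_apply_left w' hac hab hbc.symm h1 h3 h2, this]
  rw [apply_eq w ha hb hc hab hac hbc, apply_eq w' ha hb hc hab hac hbc, h a b ha hb hab,
    h a c ha hc hac, h b c hb hc hbc]

theorem bar_ne_self (a : SignedIndex n) : bar a ≠ a := fun e =>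
  absurd (congrArg Prod.snd e) (by simp [bar])

/-- Opposite indices lie on different sides of `0̄`. -/
theorem cut_neg_zero_bar (w : SolutionSet n) {a : SignedIndex n} (ha : pos 0 ≠ a)
    (ha' : neg 0 ≠ a) : w.cut (neg 0) (bar a) = 1 - w.cut (neg 0) a := by
  have h0 : pos 0 ≠ (neg 0 : SignedIndex n) := by simp [pos, neg]
  have hb : pos 0 ≠ bar a := fun e => ha' (by rw [← bar_bar a, ← e]; rfl)
  have hb' : neg 0 ≠ bar a := fun e => ha (by rw [← bar_bar a, ← e]; rfl)
  have h1 := w.2 _ (Relation.antipode (pos 0) (pos 0) a h0.symm ha' ha)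
  simp only [y, map_sub, MvPolynomial.eval_X] at h1
  rw [cut_eq w h0 ha ha', cut_eq w h0 hb hb',
    w.swap_apply_left h0 ha ha' hb.symm hb'.symm (bar_ne_self a)]
  simp only [bar, pos, neg, Bool.not_false] at h1 ⊢
  linarith

/-- The antipode preserves the order on each side of `0̄`. -/
theorem cut_bar_bar (w : SolutionSet n) {a b : SignedIndex n} (ha : pos 0 ≠ a) (ha' : neg 0 ≠ a)
    (hb : pos 0 ≠ b) (hb' : neg 0 ≠ b) (hab : a ≠ b) :
    w.cut (bar a) (bar b) = w.cut (neg 0) a - w.cut (neg 0) b + w.cut a b := by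
  have h0 : pos 0 ≠ (neg 0 : SignedIndex n) := by simp [pos, neg]
  have h1 := w.2 _ (Relation.antipode (pos 0) a b ha' hb' hab)
  simp only [y, map_sub, MvPolynomial.eval_X] at h1
  rw [cut_eq w (ne_bar (i := pos 0) ha') (ne_bar (i := pos 0) hb') (bar_ne_bar hab),
    ← w.apply_eq h0 ha hb ha' hb' hab]
  linarith!

end SolutionSet

end TypeB

/-! ### Spanning by hand monomials -/

theorem Finset.image_rank_eq_range {α : Type*} [DecidableEq α] {D : Finset α} {r : α → ℕ}
    (hinj : Set.InjOn r D) (hr : ∀ a ∈ D, r a < D.card) : D.image r = Finset.range D.card := by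
  refine Finset.eq_of_subset_of_card_le (fun x hx => ?_) ?_
  · obtain ⟨a, ha, rfl⟩ := Finset.mem_image.1 hx
    exact Finset.mem_range.2 (hr a ha)
  · rw [Finset.card_range, Finset.card_image_of_injOn hinj]

namespace TypeB

theorem pos_zero_ne_neg {n : ℕ} (j : Fin (n + 1)) : (pos 0 : SignedIndex n) ≠ neg j :=
  by simp [pos, neg]

theorem pos_zero_ne {n : ℕ} {a : SignedIndex n} (h : a.1 ≠ 0) : pos 0 ≠ a :=
  fun e => h (by rw [← e])

theorem neg_zero_ne {n : ℕ} {a : SignedIndex n} (h : a.1 ≠ 0) : neg 0 ≠ a :=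
  fun e => h (by rw [← e])

theorem pos_ne_of_lt {n : ℕ} {i j : Fin (n + 1)} (h : i < j) (s : Bool) : pos i ≠ (j, s) :=
  fun e => h.ne (congrArg Prod.fst e)

namespace SolutionSet

variable {n : ℕ}

theorem cut_zero_left (w : SolutionSet n) (b : SignedIndex n) : w.cut (pos 0) b = 0 :=
  dif_neg fun h => h.1 rfl

theorem cut_zero_right (w : SolutionSet n) (a : SignedIndex n) : w.cut a (pos 0) = 0 :=
  dif_neg fun h => h.2.1 rfl

theorem cut_self (w : SolutionSet n) (a : SignedIndex n) : w.cut a a = 0 :=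
  dif_neg fun h => h.2.2 rfl

/-- An index and its antipode are ordered according to their sides of `0̄`. -/
theorem cut_bar_self (w : SolutionSet n) {a : SignedIndex n} (ha : pos 0 ≠ a) (ha' : neg 0 ≠ a) :
    w.cut a (bar a) = 1 - w.cut (neg 0) a := by
  have h0 := pos_zero_ne_neg (n := n) 0
  have hb : pos 0 ≠ bar a := fun e => ha' (by rw [← bar_bar a, ← e]; rfl)
  have hb' : neg 0 ≠ bar a := fun e => ha (by rw [← bar_bar a, ← e]; rfl)
  have h1 := w.cut_neg_zero_bar ha ha'
  have h2 := w.cut_swap h0 ha ha'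
  have h3 := w.cut_swap h0 hb hb'
  have h4 := w.cut_swap ha hb (bar_ne_self a).symm
  rcases w.cut_eq_zero_or (neg 0) a with h | h
  · rw [w.cut_trans ha h0 hb ha'.symm (bar_ne_self a).symm hb' (by linarith) (by linarith), h]
    norm_num
  · have := w.cut_trans hb h0 ha hb'.symm (bar_ne_self a) ha' (by linarith) h
    linarith

/-- Two solutions agree on the indices of absolute value less than `m`: they restrict to the same
signed cyclic order there. -/
def Agree (m : ℕ) (w w' : SolutionSet n) : Prop :=
  ∀ a b : SignedIndex n, (a.1 : ℕ) < m → (b.1 : ℕ) < m → w.cut a b = w'.cut a b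

theorem Agree.symm {m : ℕ} {w w' : SolutionSet n} (h : Agree m w w') : Agree m w' w :=
  fun a b ha hb => (h a b ha hb).symm

theorem Agree.trans {m : ℕ} {w w' w'' : SolutionSet n} (h : Agree m w w') (h' : Agree m w' w'') :
    Agree m w w'' :=
  fun a b ha hb => (h a b ha hb).trans (h' a b ha hb)

/-- The indices `0` and `0̄` alone carry no information. -/
theorem agree_one (w w' : SolutionSet n) : Agree 1 w w' := by
  have key (w : SolutionSet n) (a b : SignedIndex n) (ha : (a.1 : ℕ) < 1) (hb : (b.1 : ℕ) < 1) :
      w.cut a b = 0 := by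
    obtain ⟨i, s⟩ := a
    obtain ⟨j, t⟩ := b
    obtain rfl : i = 0 := Fin.ext (by simpa using ha)
    obtain rfl : j = 0 := Fin.ext (by simpa using hb)
    cases s
    · exact w.cut_zero_left _
    · cases t
      · exact w.cut_zero_right _
      · exact w.cut_self _
  intro a b ha hb
  rw [key w a b ha hb, key w' a b ha hb]

theorem Agree.eq {w w' : SolutionSet n} (h : Agree (n + 1) w w') : w = w' :=
  ext_cut fun a b _ _ _ => h a b a.1.2 b.1.2

/-- The indices other than `0` whose absolute value is less than `m`. -/
def lower (n m : ℕ) : Finset (SignedIndex n) :=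
  Finset.univ.filter fun a => (a.1 : ℕ) < m ∧ pos 0 ≠ a

theorem mem_lower {m : ℕ} {a : SignedIndex n} : a ∈ lower n m ↔ (a.1 : ℕ) < m ∧ pos 0 ≠ a := by
  simp [lower]

/-- The number of indices in `lower n m` that precede `a` in the linear order cut out at `0`. -/
def rank (m : ℕ) (w : SolutionSet n) (a : SignedIndex n) : ℕ :=
  ((lower n m).filter fun b => w.cut b a = 1).card

theorem rank_lt_rank {m : ℕ} (w : SolutionSet n) {a b : SignedIndex n} (ha : a ∈ lower n m)
    (hb : pos 0 ≠ b) (hab : w.cut a b = 1) : rank m w a < rank m w b := by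
  have hne : a ≠ b := by
    rintro rfl
    rw [cut_self] at hab
    exact zero_ne_one hab
  have ha0 := (mem_lower.1 ha).2
  refine Finset.card_lt_card (Finset.ssubset_iff_of_subset (fun c hc => ?_) |>.2 ⟨a, ?_, ?_⟩)
  · rw [Finset.mem_filter] at hc ⊢
    have hc0 := (mem_lower.1 hc.1).2
    have hca : c ≠ a := by
      rintro rfl
      rw [cut_self] at hc
      exact zero_ne_one hc.2
    refine ⟨hc.1, ?_⟩
    have hcb : c ≠ b := by
      rintro rfl
      have := w.cut_swap ha0 hc0 hne
      linarith [hc.2]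
    exact w.cut_trans hc0 ha0 hb hca hcb hne hc.2 hab
  · exact Finset.mem_filter.2 ⟨ha, hab⟩
  · simp [cut_self]

theorem injOn_rank (m : ℕ) (w : SolutionSet n) : Set.InjOn (rank m w) (lower n m) := by
  intro a ha b hb h
  by_contra hne
  have ha0 := (mem_lower.1 ha).2
  have hb0 := (mem_lower.1 hb).2
  have := w.cut_swap ha0 hb0 hne
  rcases w.cut_eq_zero_or a b with h1 | h1
  · exact absurd h (rank_lt_rank w hb ha0 (by linarith)).ne'
  · exact absurd h (rank_lt_rank w ha hb0 h1).ne

theorem Agree.rank_eq {m : ℕ} {w w' : SolutionSet n} (h : Agree m w w') {a : SignedIndex n}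
    (ha : (a.1 : ℕ) < m) : rank m w a = rank m w' a := by
  unfold rank
  congr 1
  exact Finset.filter_congr fun b hb => by rw [h b a (mem_lower.1 hb).1 ha]

/-- The ranks of the indices that precede `c` form an initial segment. -/
theorem image_rank (m : ℕ) (w : SolutionSet n) {c : SignedIndex n} (hc : pos 0 ≠ c) :
    ((lower n m).filter fun b => w.cut b c = 1).image (rank m w) = Finset.range (rank m w c) := by
  refine Finset.image_rank_eq_range
    ((injOn_rank m w).mono fun a ha => (Finset.mem_filter.1 ha).1) fun a ha => ?_
  rw [Finset.mem_filter] at ha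
  exact rank_lt_rank w ha.1 hc ha.2

theorem cut_eq_one_iff {m : ℕ} (w : SolutionSet n) {a c : SignedIndex n} (ha : a ∈ lower n m)
    (hc : pos 0 ≠ c) : w.cut a c = 1 ↔ rank m w a < rank m w c := by
  refine ⟨rank_lt_rank w ha hc, fun h => ?_⟩
  rw [← Finset.mem_range, ← image_rank m w hc, Finset.mem_image] at h
  obtain ⟨b, hb, hba⟩ := h
  rw [Finset.mem_filter] at hb
  rw [← injOn_rank m w hb.1 ha hba]
  exact hb.2

/-- A signed cyclic order is determined by its restriction to the indices of absolute value less
than `m` together with the position of the index `m`. -/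
theorem Agree.succ {m : Fin (n + 1)} (hm : m ≠ 0) {w w' : SolutionSet n} (h : Agree m w w')
    (hr : rank m w (pos m) = rank m w' (pos m)) : Agree (m + 1) w w' := by
  have hm0 : 0 < (m : ℕ) := Nat.pos_of_ne_zero fun e => hm (Fin.ext e)
  have hp : pos 0 ≠ pos m := pos_zero_ne hm
  have hq : pos 0 ≠ neg m := pos_zero_ne hm
  have hp' : neg 0 ≠ pos m := neg_zero_ne hm
  have hz : (pos 0 : SignedIndex n) ≠ neg 0 := pos_zero_ne_neg 0
  have lt_ne {a : SignedIndex n} (ha : (a.1 : ℕ) < m) (s : Bool) : a ≠ (m, s) := by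
    rintro rfl
    exact lt_irrefl _ ha
  have key (a : SignedIndex n) (ha : (a.1 : ℕ) < m) : w.cut a (pos m) = w'.cut a (pos m) := by
    by_cases ha0 : pos 0 = a
    · rw [← ha0, cut_zero_left, cut_zero_left]
    have hl : a ∈ lower n m := mem_lower.2 ⟨ha, ha0⟩
    have := w.cut_eq_one_iff hl hp
    rw [h.rank_eq ha, hr, ← w'.cut_eq_one_iff hl hp] at this
    rcases w.cut_eq_zero_or a (pos m) with h1 | h1 <;>
    rcases w'.cut_eq_zero_or a (pos m) with h2 | h2 <;> simp_all
  have key2 (a : SignedIndex n) (ha : (a.1 : ℕ) < m) : w.cut a (neg m) = w'.cut a (neg m) := by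
    by_cases ha0 : pos 0 = a
    · rw [← ha0, cut_zero_left, cut_zero_left]
    by_cases ha1 : neg 0 = a
    · have e (w : SolutionSet n) := w.cut_neg_zero_bar hp hp'
      simp only [bar, pos, neg, Bool.not_false] at e
      rw [← ha1, e, e]
      exact congrArg _ (key (neg 0) hm0)
    · have e (w : SolutionSet n) := w.cut_bar_bar (a := bar a) (b := pos m)
        (fun e => ha1 (by rw [← bar_bar a, ← e]; rfl))
        (fun e => ha0 (by rw [← bar_bar a, ← e]; rfl))
        hp hp' (lt_ne (a := bar a) ha false)
      rw [bar_bar, show bar (pos m) = neg m from rfl] at e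
      rw [e, e, key (bar a) ha, key (neg 0) hm0, h (neg 0) (bar a) hm0 ha]
  have keys (a : SignedIndex n) (ha : (a.1 : ℕ) < m) (s : Bool) :
      w.cut a (m, s) = w'.cut a (m, s) := by
    cases s
    · exact key a ha
    · exact key2 a ha
  have hself : w.cut (pos m) (neg m) = w'.cut (pos m) (neg m) := by
    have e (w : SolutionSet n) := w.cut_bar_self hp hp'
    rw [show bar (pos m) = neg m from rfl] at e
    rw [e, e, key (neg 0) hm0]
  rintro ⟨i, s⟩ ⟨j, t⟩ hi hj
  rcases (Nat.lt_succ_iff_lt_or_eq.1 hi) with hi | hi <;>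
  rcases (Nat.lt_succ_iff_lt_or_eq.1 hj) with hj | hj
  · exact h _ _ hi hj
  · obtain rfl : j = m := Fin.ext hj
    exact keys _ hi t
  · obtain rfl : i = m := Fin.ext hi
    by_cases h0 : pos 0 = (j, t)
    · rw [← h0, cut_zero_right, cut_zero_right]
    · have hne := (lt_ne (a := (j, t)) hj s).symm
      rw [w.cut_swap (pos_zero_ne hm) h0 hne, w'.cut_swap (pos_zero_ne hm) h0 hne, keys _ hj s]
  · obtain rfl : i = m := Fin.ext hi
    obtain rfl : j = i := Fin.ext hj
    cases s <;> cases t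
    · rw [cut_self, cut_self]
    · exact hself
    · have hne : neg j ≠ pos j := by simp [pos, neg]
      rw [w.cut_swap hq hp hne, w'.cut_swap hq hp hne, hself]
    · rw [cut_self, cut_self]

open Classical in
/-- The value of `f` at a solution that agrees with `w` up to `m - 1` and in which the index `m`
has rank `j`, or `0` if there is no such solution. -/
def valueAtRank (m : Fin (n + 1)) (f : SolutionSet n → ℤ) (w : SolutionSet n) (j : ℕ) : ℤ :=
  if h : ∃ w', Agree m w w' ∧ rank m w' (pos m) = j then f h.choose else 0

theorem Agree.valueAtRank_eq {m : Fin (n + 1)} {w w' : SolutionSet n} (h : Agree m w w')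
    (f : SolutionSet n → ℤ) (j : ℕ) : valueAtRank m f w j = valueAtRank m f w' j := by
  have : Agree (m : ℕ) w = Agree (m : ℕ) w' :=
    funext fun v => propext ⟨fun hv => h.symm.trans hv, fun hv => h.trans hv⟩
  unfold valueAtRank
  rw [this]

theorem valueAtRank_self {m : Fin (n + 1)} (hm : m ≠ 0) {f : SolutionSet n → ℤ}
    (hf : ∀ w w', Agree (m + 1) w w' → f w = f w') (w : SolutionSet n) :
    valueAtRank m f w (rank m w (pos m)) = f w := by
  have h : ∃ w', Agree m w w' ∧ rank m w' (pos m) = rank m w (pos m) := ⟨w, fun _ _ _ _ => rfl, rfl⟩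
  rw [valueAtRank, dif_pos h]
  exact (hf _ _ (h.choose_spec.1.succ hm h.choose_spec.2.symm)).symm

/-- A function of the signed cyclic order up to `m` is a combination of `1` and of the `y_0am`,
where `a` runs over the indices of absolute value less than `m`, with coefficients that depend
only on the order up to `m - 1`: telescope over the positions passed by the index `m` while it
moves counter-clockwise from `0`. -/
theorem eq_add_sum_cut {m : Fin (n + 1)} (hm : m ≠ 0) {f : SolutionSet n → ℤ}
    (hf : ∀ w w', Agree (m + 1) w w' → f w = f w') (w : SolutionSet n) :
    f w = valueAtRank m f w 0 + ∑ a ∈ lower n m,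
      (valueAtRank m f w (rank m w a + 1) - valueAtRank m f w (rank m w a)) * w.cut a (pos m) := by
  have hp : pos 0 ≠ pos m := pos_zero_ne hm
  have h1 : ∑ a ∈ lower n m,
      (valueAtRank m f w (rank m w a + 1) - valueAtRank m f w (rank m w a)) * w.cut a (pos m) =
      ∑ a ∈ (lower n m).filter fun b => w.cut b (pos m) = 1,
        (valueAtRank m f w (rank m w a + 1) - valueAtRank m f w (rank m w a)) := by
    rw [Finset.sum_filter]
    refine Finset.sum_congr rfl fun a _ => ?_
    rcases w.cut_eq_zero_or a (pos m) with h | h <;> simp [h]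
  rw [h1, ← Finset.sum_image (s := (lower n m).filter fun b => w.cut b (pos m) = 1)
    (g := rank m w) (f := fun j => valueAtRank m f w (j + 1) - valueAtRank m f w j)
    ((injOn_rank m w).mono fun a ha => (Finset.mem_filter.1 ha).1), image_rank _ w hp,
    Finset.sum_range_sub, valueAtRank_self hm hf]
  ring

end SolutionSet

/-! ### Hand monomials -/

/-- Labels for the number `1` and the fingers of the hand `h_(k+1)`: the two Booleans stand for
`1` and `y_00̄(k+1)`, the pair `(j, s)` for `y_0(j+1)(k+1)` with a bar over `k + 1` if `s` holds. -/
abbrev Finger {n : ℕ} (k : Fin n) : Type := Bool ⊕ Fin k × Bool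

/-- The finger with a given label. -/
def finger {n : ℕ} (k : Fin n) : Finger k → HeavisidePoly n
  | .inl false => 1
  | .inl true => y (pos 0) (neg 0) (pos k.succ) (pos_zero_ne_neg 0)
      (pos_zero_ne (Fin.succ_ne_zero k)) (neg_zero_ne (Fin.succ_ne_zero k))
  | .inr (j, s) => y (pos 0) (pos (j.castLE k.2.le).succ) (k.succ, s)
      (pos_zero_ne (Fin.succ_ne_zero (j.castLE k.2.le))) (pos_zero_ne (Fin.succ_ne_zero k))
      (pos_ne_of_lt (Fin.succ_lt_succ_iff.2 (Fin.lt_def.2 j.2)) s)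

/-- The product of one finger, or `1`, of each hand. -/
def fingerMonomial {n : ℕ} (c : ∀ k : Fin n, Finger k) : HeavisidePoly n := ∏ k, finger k (c k)

theorem range_finger {n : ℕ} (k : Fin n) :
    Set.range (finger k) = {f | f = 1 ∨ f ∈ hand k.succ} := by
  ext f
  simp only [Set.mem_range, Set.mem_ofPred_eq, hand]
  constructor
  · rintro ⟨(_ | _) | ⟨j, _ | _⟩, rfl⟩
    · exact Or.inl rfl
    · exact Or.inr (Or.inl ⟨pos_zero_ne_neg 0, pos_zero_ne (Fin.succ_ne_zero k),
        neg_zero_ne (Fin.succ_ne_zero k), rfl⟩)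
    all_goals
      have hj : (j.castLE k.2.le).succ < k.succ := Fin.succ_lt_succ_iff.2 (Fin.lt_def.2 j.2)
      refine Or.inr (Or.inr ⟨(j.castLE k.2.le).succ, Fin.succ_pos _, hj, ?_⟩)
    · exact Or.inl ⟨pos_zero_ne (Fin.succ_ne_zero (j.castLE k.2.le)),
        pos_zero_ne (Fin.succ_ne_zero k),
        pos_ne_of_lt hj _, rfl⟩
    · exact Or.inr ⟨pos_zero_ne (Fin.succ_ne_zero (j.castLE k.2.le)),
        pos_zero_ne (Fin.succ_ne_zero k),
        pos_ne_of_lt hj _, rfl⟩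
  · rintro (rfl | ⟨_, _, _, rfl⟩ | ⟨⟨_ | j, hj⟩, h0, hk, h⟩)
    · exact ⟨.inl false, rfl⟩
    · exact ⟨.inl true, rfl⟩
    · simp at h0
    · have hjk : j < k := by simpa [Fin.lt_def] using hk
      rcases h with ⟨_, _, _, rfl⟩ | ⟨_, _, _, rfl⟩
      · exact ⟨.inr (⟨j, hjk⟩, false), rfl⟩
      · exact ⟨.inr (⟨j, hjk⟩, true), rfl⟩

theorem range_fingerMonomial (n : ℕ) : Set.range (fingerMonomial (n := n)) = handMonomials n := by
  ext f
  constructor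
  · rintro ⟨c, rfl⟩
    exact ⟨fun k => finger k (c k), fun k => (range_finger k).subset ⟨c k, rfl⟩, rfl⟩
  · rintro ⟨c, hc, rfl⟩
    choose d hd using fun k => (range_finger k).superset (hc k)
    exact ⟨d, Finset.prod_congr rfl fun k _ => hd k⟩

theorem card_fingers (n : ℕ) : Fintype.card (∀ k : Fin n, Finger k) = 2 ^ n * n.factorial := by
  simp only [Fintype.card_pi, Fintype.card_sum, Fintype.card_prod, Fintype.card_bool,
    Fintype.card_fin]
  rw [Fin.prod_univ_eq_prod_range (fun k => 2 + k * 2)]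
  induction n with
  | zero => rfl
  | succ n ih =>
    rw [Finset.prod_range_succ, ih, Nat.factorial_succ, pow_succ]
    ring

theorem fingerMonomial_update {n : ℕ} (c : ∀ k : Fin n, Finger k) (k : Fin n)
    (hc : c k = .inl false) (x : Finger k) :
    fingerMonomial (Function.update c k x) = fingerMonomial c * finger k x := by
  unfold fingerMonomial
  rw [← Finset.mul_prod_erase _ _ (Finset.mem_univ k), ← Finset.mul_prod_erase
    (a := k) _ (fun k => finger k (c k)) (Finset.mem_univ k), Function.update_self, hc]
  rw [Finset.prod_congr rfl fun i hi => by
    rw [Function.update_of_ne (Finset.ne_of_mem_erase hi)]]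
  simp only [finger]
  ring

namespace SolutionSet

variable {n : ℕ}

/-- The functions spanned by the products of fingers of the hands `h_1, …, h_m`. -/
def spanBelow (n m : ℕ) : Submodule ℤ (SolutionSet n → ℤ) :=
  Submodule.span ℤ {f | ∃ c : ∀ k : Fin n, Finger k,
    (∀ k : Fin n, m ≤ k → c k = .inl false) ∧ f = ev (fingerMonomial c)}

theorem mul_finger_mem (k : Fin n) (x : Finger k) {g : SolutionSet n → ℤ}
    (hg : g ∈ spanBelow n k) : g * ev (finger k x) ∈ spanBelow n (k + 1) := by
  induction hg using Submodule.span_induction with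
  | mem g hg =>
    obtain ⟨c, hc, rfl⟩ := hg
    refine Submodule.subset_span ⟨Function.update c k x, fun i hi => ?_, ?_⟩
    · have : i ≠ k := fun e => by rw [e] at hi; omega
      rw [Function.update_of_ne this]
      exact hc i (by omega)
    · rw [fingerMonomial_update c k (hc k le_rfl), map_mul]
  | zero => rw [zero_mul]; exact zero_mem _
  | add g h _ _ hg hh => rw [add_mul]; exact add_mem hg hh
  | smul z g _ hg => rw [smul_mul_assoc]; exact Submodule.smul_mem _ z hg

/-- Multiplication by `y_0ak` with `a` below `k` is realized by the fingers of the hand `h_k`; for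
barred `a` this uses `y_0ak = y_00̄ā - 1 + y_00̄k + y_0āk̄`. -/
theorem mul_cut_mem (k : Fin n) {a : SignedIndex n} (ha : a ∈ lower n k.succ)
    (hspan : ∀ f : SolutionSet n → ℤ, (∀ w w', Agree (k + 1) w w' → f w = f w') → f ∈ spanBelow n k)
    {g : SolutionSet n → ℤ} (hg : ∀ w w', Agree (k + 1) w w' → g w = g w') :
    (fun w => g w * w.cut a (pos k.succ)) ∈ spanBelow n (k + 1) := by
  have hk : k.succ ≠ 0 := Fin.succ_ne_zero k
  have hp : pos 0 ≠ pos k.succ := pos_zero_ne hk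
  have hp' : neg 0 ≠ pos k.succ := neg_zero_ne hk
  have htrue : (ev (finger k (.inl true)) : SolutionSet n → ℤ) =
      fun w => w.cut (neg 0) (pos k.succ) :=
    funext fun w => ev_y w (pos_zero_ne_neg 0) hp hp'
  rw [mem_lower] at ha
  obtain ⟨⟨j, hj⟩, s⟩ := a
  obtain ⟨hjk, h0⟩ := ha
  cases j with
  | zero =>
    cases s
    · exact absurd rfl h0
    · have := mul_finger_mem k (.inl true) (hspan g hg)
      rwa [htrue] at this
  | succ j =>
    have hj' : j < k := by simpa using hjk
    have hne : (⟨j + 1, hj⟩ : Fin (n + 1)) ≠ 0 := Fin.succ_ne_zero ⟨j, by omega⟩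
    have hlt : (⟨j + 1, hj⟩ : Fin (n + 1)) < k.succ := Fin.lt_def.2 hjk
    have hfin (s : Bool) : (ev (finger k (.inr (⟨j, hj'⟩, s))) : SolutionSet n → ℤ) =
        fun w => w.cut (pos ⟨j + 1, hj⟩) (k.succ, s) := funext fun w =>
      ev_y w (pos_zero_ne hne) (pos_zero_ne hk) (pos_ne_of_lt hlt s)
    cases s
    · have := mul_finger_mem k (.inr (⟨j, hj'⟩, false)) (hspan g hg)
      rwa [hfin] at this
    · have hjn : pos ⟨j + 1, hj⟩ ≠ neg k.succ := pos_ne_of_lt hlt true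
      -- `a = j̄` for an unbarred `j`, so that the fingers `y_00̄k` and `y_0jk̄` are available
      have e (w : SolutionSet n) : g w * w.cut (neg ⟨j + 1, hj⟩) (pos k.succ) =
          g w * (w.cut (neg 0) (pos ⟨j + 1, hj⟩) - 1) * 1 +
            g w * w.cut (neg 0) (pos k.succ) + g w * w.cut (pos ⟨j + 1, hj⟩) (neg k.succ) := by
        have h1 := w.cut_bar_bar (pos_zero_ne hne) (neg_zero_ne hne)
          (pos_zero_ne (a := neg k.succ) hk) (neg_zero_ne hk) hjn
        have h2 := w.cut_neg_zero_bar hp hp'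
        simp only [bar, pos, neg, Bool.not_false, Bool.not_true] at h1 h2 ⊢
        rw [h1, h2]
        ring
      have h1 := mul_finger_mem k (.inl false)
        (hspan (fun w => g w * (w.cut (neg 0) (pos ⟨j + 1, hj⟩) - 1)) fun w w' h => by
          rw [hg w w' h, h (neg 0) (pos ⟨j + 1, hj⟩) (Nat.succ_pos _) hjk])
      have h2 := mul_finger_mem k (.inl true) (hspan g hg)
      have h3 := mul_finger_mem k (.inr (⟨j, hj'⟩, true)) (hspan g hg)
      rw [htrue] at h2
      rw [hfin] at h3
      have := add_mem (add_mem h1 h2) h3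
      convert this using 1
      funext w
      simpa [finger] using e w

/-- Every function that depends only on the signed cyclic order up to `m` is a combination of
products of fingers of `h_1, …, h_m`. -/
theorem mem_spanBelow (m : ℕ) (hm : m ≤ n) (f : SolutionSet n → ℤ)
    (hf : ∀ w w', Agree (m + 1) w w' → f w = f w') : f ∈ spanBelow n m := by
  induction m generalizing f with
  | zero =>
    rcases isEmpty_or_nonempty (SolutionSet n) with he | ⟨⟨w₀⟩⟩
    · rw [Subsingleton.elim f 0]
      exact zero_mem _
    · have : f = f w₀ • ev (fingerMonomial fun _ => .inl false) := by
        funext w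
        simp [fingerMonomial, finger, hf w w₀ (agree_one w w₀)]
      rw [this]
      exact Submodule.smul_mem _ _ (Submodule.subset_span ⟨_, fun _ _ => rfl, rfl⟩)
  | succ m ih =>
    have hspan := ih (by omega)
    let k : Fin n := ⟨m, hm⟩
    have hk : k.succ ≠ 0 := Fin.succ_ne_zero k
    have : f = (fun w => valueAtRank k.succ f w 0) * ev (finger k (.inl false)) +
        ∑ a ∈ lower n k.succ, fun w => (valueAtRank k.succ f w (rank k.succ w a + 1) -
          valueAtRank k.succ f w (rank k.succ w a)) * w.cut a (pos k.succ) := by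
      funext w
      rw [eq_add_sum_cut (m := k.succ) hk hf w]
      simp [finger]
    rw [this]
    refine add_mem (mul_finger_mem k _ (hspan _ fun w w' h =>
      Agree.valueAtRank_eq (m := k.succ) h f 0)) (sum_mem fun a ha => mul_cut_mem k ha hspan ?_)
    intro w w' h
    have hr : rank k.succ w a = rank k.succ w' a := Agree.rank_eq h (mem_lower.1 ha).1
    rw [hr, Agree.valueAtRank_eq (m := k.succ) h, Agree.valueAtRank_eq (m := k.succ) h]

theorem span_fingerMonomial :
    Submodule.span ℤ (Set.range fun c => ev (fingerMonomial (n := n) c)) = ⊤ := by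
  refine eq_top_iff.2 fun f _ => ?_
  refine Submodule.span_mono ?_ (mem_spanBelow n le_rfl f fun w w' h => by rw [h.eq])
  rintro _ ⟨c, -, rfl⟩
  exact ⟨c, rfl⟩

end SolutionSet

/-! ### Cyclic orders on the circle -/

theorem circleExp_pi : Circle.exp Real.pi = -1 := by
  refine Circle.ext ?_
  rw [Circle.coe_exp, Complex.exp_pi_mul_I]
  rfl

theorem IsCCW.rotate {p q r : Circle} (h : IsCCW p q r) : IsCCW q r p := by
  obtain ⟨a, b, c, hab, hbc, hca, rfl, rfl, rfl⟩ := h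
  exact ⟨b, c, a + 2 * Real.pi, hbc, hca, by linarith, rfl, rfl, Circle.periodic_exp a⟩

theorem isCCW_exp_of_lt {a b c : ℝ} (hab : a < b) (hbc : b < c) (hca : c < a + 2 * Real.pi) :
    IsCCW (Circle.exp a) (Circle.exp b) (Circle.exp c) :=
  ⟨a, b, c, hab, hbc, hca, rfl, rfl, rfl⟩

theorem isCCW_exp_iff_of_lt {a b c : ℝ} (hab : a < b) (hac : a < c) (hbc : b ≠ c)
    (hb : b < a + 2 * Real.pi) (hc : c < a + 2 * Real.pi) :
    IsCCW (Circle.exp a) (Circle.exp b) (Circle.exp c) ↔ b < c := by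
  refine ⟨fun h => ?_, fun h => isCCW_exp_of_lt hab h hc⟩
  by_contra hcon
  exact h.not_swap (isCCW_exp_of_lt hac (lt_of_le_of_ne (not_lt.1 hcon) hbc.symm) hb)

theorem isCCW_exp_iff {m a b c : ℝ} (ha : m < a) (hb : m < b) (hc : m < c)
    (ha' : a < m + 2 * Real.pi) (hb' : b < m + 2 * Real.pi) (hc' : c < m + 2 * Real.pi)
    (hab : a ≠ b) (hac : a ≠ c) (hbc : b ≠ c) :
    IsCCW (Circle.exp a) (Circle.exp b) (Circle.exp c) ↔
      (a < b ∧ b < c) ∨ (b < c ∧ c < a) ∨ (c < a ∧ a < b) := by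
  have key {a b c : ℝ} (ha : m < a) (hc : c < m + 2 * Real.pi) (h : a < b ∧ b < c) :
      IsCCW (Circle.exp a) (Circle.exp b) (Circle.exp c) :=
    isCCW_exp_of_lt h.1 h.2 (by linarith)
  constructor
  · intro h
    by_contra hcon
    apply h.not_swap
    rcases lt_or_gt_of_ne hab with h1 | h1 <;> rcases lt_or_gt_of_ne hac with h2 | h2 <;>
      rcases lt_or_gt_of_ne hbc with h3 | h3
    · exact absurd (Or.inl ⟨h1, h3⟩) hcon
    · exact key ha hb' ⟨h2, h3⟩
    · exact absurd (h1.trans h3) h2.not_gt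
    · exact absurd (Or.inr (Or.inr ⟨h2, h1⟩)) hcon
    · exact (key hb hc' ⟨h1, h2⟩).rotate
    · exact absurd (h2.trans h3) h1.not_gt
    · exact absurd (Or.inr (Or.inl ⟨h3, h2⟩)) hcon
    · exact (key hc ha' ⟨h3, h1⟩).rotate.rotate
  · rintro (h | h | h)
    · exact key ha hc' h
    · exact (key hb ha' h).rotate.rotate
    · exact (key hc hb' h).rotate

/-- Four points of the circle, cut at the first one: the other three have arguments in an interval
of length `2π`, where cyclic orders are compared by inequalities. -/
theorem exists_window (p q r s : Circle) (hpq : p ≠ q) (hpr : p ≠ r) (hps : p ≠ s) :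
    ∃ m a b c : ℝ, (m < a ∧ a < m + 2 * Real.pi) ∧ (m < b ∧ b < m + 2 * Real.pi) ∧
      (m < c ∧ c < m + 2 * Real.pi) ∧ Circle.exp m = p ∧ Circle.exp a = q ∧ Circle.exp b = r ∧
      Circle.exp c = s := by
  obtain ⟨m, rfl⟩ := Circle.exp_surjective p
  obtain ⟨a, ha, ha', rfl⟩ := exists_lift m q hpq
  obtain ⟨b, hb, hb', rfl⟩ := exists_lift m r hpr
  obtain ⟨c, hc, hc', rfl⟩ := exists_lift m s hps
  exact ⟨m, a, b, c, ⟨ha, ha'⟩, ⟨hb, hb'⟩, ⟨hc, hc'⟩, rfl, rfl, rfl, rfl⟩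

theorem point_bar {n : ℕ} (p : OrbitConf n) (i : SignedIndex n) :
    p.point (bar i) = -1 * p.point i := by
  obtain ⟨i, _ | _⟩ := i <;> simp [OrbitConf.point, bar]

theorem isCCW_bar_iff {n : ℕ} (p : OrbitConf n) (i j k : SignedIndex n) :
    IsCCW (p.point (bar i)) (p.point j) (p.point k) ↔
      IsCCW (p.point i) (p.point (bar j)) (p.point (bar k)) := by
  rw [← isCCW_smul_iff (-1), ← point_bar, ← point_bar, ← point_bar, bar_bar]

open Classical in
/-- The signed cyclic Heaviside functions satisfy the five families of relations. -/
theorem eval_heavisideFun_eq_zero {n : ℕ} (z : Y n) {r : HeavisidePoly n} (hr : Relation n r) :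
    MvPolynomial.eval (fun t : Triple n => heavisideFun t.1.1 t.1.2.1 t.1.2.2 z) r = 0 := by
  induction z using Quotient.inductionOn with
  | h p =>
  have hval (i j k : SignedIndex n) : heavisideFun i j k (Quotient.mk _ p) =
    if IsCCW (p.point i) (p.point j) (p.point k) then 1 else 0 := rfl
  cases hr with
  | idem i j k hij hik hjk =>
    simp only [y, map_mul, map_sub, map_one, MvPolynomial.eval_X, hval]
    split_ifs <;> rfl
  | swap i j k hij hik hjk =>
    simp only [y, map_sub, map_one, MvPolynomial.eval_X, hval]
    rcases isCCW_or (point_ne p hij) (point_ne p hik) (point_ne p hjk) with h | h <;>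
      simp [h, h.not_swap]
  | antipode i j k hij hik hjk =>
    simp only [y, map_sub, MvPolynomial.eval_X, hval, isCCW_bar_iff, sub_self]
  | alternating i j k l hij hik hil hjk hjl hkl =>
    simp only [y, map_sub, map_add, MvPolynomial.eval_X, hval]
    obtain ⟨m, a, b, c, ⟨ha, ha'⟩, ⟨hb, hb'⟩, ⟨hc, hc'⟩, hm, hpa, hpb, hpc⟩ := exists_window _ _ _ _
      (point_ne p hij) (point_ne p hik) (point_ne p hil)
    have hab : a ≠ b := fun e => point_ne p hjk (by rw [← hpa, ← hpb, e])
    have hac : a ≠ c := fun e => point_ne p hjl (by rw [← hpa, ← hpc, e])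
    have hbc : b ≠ c := fun e => point_ne p hkl (by rw [← hpb, ← hpc, e])
    rw [← hm, ← hpa, ← hpb, ← hpc]
    simp only [isCCW_exp_iff_of_lt ha hb hab ha' hb', isCCW_exp_iff_of_lt ha hc hac ha' hc',
      isCCW_exp_iff_of_lt hb hc hbc hb' hc', isCCW_exp_iff ha hb hc ha' hb' hc' hab hac hbc]
    rcases lt_or_gt_of_ne hab with h1 | h1 <;> rcases lt_or_gt_of_ne hac with h2 | h2 <;>
      rcases lt_or_gt_of_ne hbc with h3 | h3 <;>
      first
        | (exfalso; linarith)
        | simp [h1, h2, h3, h1.not_gt, h2.not_gt, h3.not_gt]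
  | transitive i j k l hij hik hil hjk hjl hkl =>
    simp only [y, map_sub, map_add, map_mul, map_one, MvPolynomial.eval_X, hval]
    obtain ⟨m, a, b, c, ⟨ha, ha'⟩, ⟨hb, hb'⟩, ⟨hc, hc'⟩, hm, hpa, hpb, hpc⟩ := exists_window _ _ _ _
      (point_ne p hij) (point_ne p hik) (point_ne p hil)
    have hab : a ≠ b := fun e => point_ne p hjk (by rw [← hpa, ← hpb, e])
    have hac : a ≠ c := fun e => point_ne p hjl (by rw [← hpa, ← hpc, e])
    have hbc : b ≠ c := fun e => point_ne p hkl (by rw [← hpb, ← hpc, e])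
    rw [← hm, ← hpa, ← hpb, ← hpc]
    simp only [isCCW_exp_iff_of_lt ha hb hab ha' hb', isCCW_exp_iff_of_lt ha hc hac ha' hc',
      isCCW_exp_iff_of_lt hb hc hbc hb' hc']
    rcases lt_or_gt_of_ne hab with h1 | h1 <;> rcases lt_or_gt_of_ne hac with h2 | h2 <;>
      rcases lt_or_gt_of_ne hbc with h3 | h3 <;>
      first
        | (exfalso; linarith)
        | simp [h1, h2, h3, h1.not_gt, h2.not_gt, h3.not_gt]

/-- The signed cyclic order of a configuration, recorded by its Heaviside functions. -/
def solution {n : ℕ} (z : Y n) : SolutionSet n :=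
  ⟨fun t => heavisideFun t.1.1 t.1.2.1 t.1.2.2 z, fun _ hr => eval_heavisideFun_eq_zero z hr⟩

theorem cut_solution {n : ℕ} (z : Y n) {a b : SignedIndex n} (ha : pos 0 ≠ a) (hb : pos 0 ≠ b)
    (hab : a ≠ b) : (solution z).cut a b = heavisideFun (pos 0) a b z :=
  SolutionSet.cut_eq _ ha hb hab

/-! ### Angle coordinates -/

/-- Angle coordinates on `Y n`: a configuration with `p₀ = 1` is given by signs `ε_k` and angles
`θ_k` in `[0, π)` with `p_k = exp (i (θ_k + π ε_k))`; here the sign `true` stands for `1`. -/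
def Chart (n : ℕ) : Type :=
  {q : (Fin (n + 1) → Bool) × (Fin (n + 1) → ℝ) // q.1 0 = false ∧ q.2 0 = 0 ∧
    (∀ k, 0 ≤ q.2 k ∧ q.2 k < Real.pi) ∧ Function.Injective q.2}

instance (n : ℕ) : TopologicalSpace (Chart n) := inferInstanceAs (TopologicalSpace (Subtype _))

namespace Chart

variable {n : ℕ}

/-- The sign `ε_k`. -/
def sgn (q : Chart n) (k : Fin (n + 1)) : Bool := q.1.1 k

/-- The angle `θ_k`. -/
def theta (q : Chart n) (k : Fin (n + 1)) : ℝ := q.1.2 k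

theorem ext' {q q' : Chart n} (h : ∀ k, q.sgn k = q'.sgn k) (h' : ∀ k, q.theta k = q'.theta k) :
    q = q' :=
  Subtype.ext (Prod.ext (funext h) (funext h'))

theorem continuous_sgn (k : Fin (n + 1)) : Continuous fun q : Chart n => q.sgn k :=
  (continuous_apply k).comp (continuous_fst.comp continuous_subtype_val)

theorem continuous_theta (k : Fin (n + 1)) : Continuous fun q : Chart n => q.theta k :=
  (continuous_apply k).comp (continuous_snd.comp continuous_subtype_val)

theorem sgn_zero (q : Chart n) : q.sgn 0 = false := q.2.1

theorem theta_zero (q : Chart n) : q.theta 0 = 0 := q.2.2.1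

theorem theta_nonneg (q : Chart n) (k : Fin (n + 1)) : 0 ≤ q.theta k := (q.2.2.2.1 k).1

theorem theta_lt_pi (q : Chart n) (k : Fin (n + 1)) : q.theta k < Real.pi := (q.2.2.2.1 k).2

theorem injective_theta (q : Chart n) : Function.Injective q.theta := q.2.2.2.2

theorem theta_pos (q : Chart n) {k : Fin (n + 1)} (hk : k ≠ 0) : 0 < q.theta k :=
  lt_of_le_of_ne (q.theta_nonneg k) fun e => hk (q.injective_theta (by rw [theta_zero, ← e]))

/-- The argument in `[0, 2π)` of the point with a given signed index. -/
def angle (q : Chart n) (i : SignedIndex n) : ℝ :=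
  q.theta i.1 + if (q.sgn i.1 ^^ i.2) = true then Real.pi else 0

theorem angle_nonneg (q : Chart n) (i : SignedIndex n) : 0 ≤ q.angle i := by
  have := q.theta_nonneg i.1
  have := Real.pi_pos
  unfold angle
  split_ifs <;> linarith

theorem angle_lt (q : Chart n) (i : SignedIndex n) : q.angle i < 2 * Real.pi := by
  have := q.theta_lt_pi i.1
  have := Real.pi_pos
  unfold angle
  split_ifs <;> linarith

theorem injective_angle (q : Chart n) : Function.Injective q.angle := by
  rintro ⟨i, s⟩ ⟨j, t⟩ h
  have h1 := q.theta_lt_pi i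
  have h2 := q.theta_lt_pi j
  have h3 := q.theta_nonneg i
  have h4 := q.theta_nonneg j
  unfold angle at h
  dsimp only at h
  split_ifs at h with h5 h6 h6
  · obtain rfl := q.injective_theta (by linarith : q.theta i = q.theta j)
    revert h5 h6
    cases q.sgn i <;> cases s <;> cases t <;> simp
  · linarith
  · linarith
  · obtain rfl := q.injective_theta (by linarith : q.theta i = q.theta j)
    revert h5 h6
    cases q.sgn i <;> cases s <;> cases t <;> simp

theorem angle_pos_zero (q : Chart n) : q.angle (pos 0) = 0 := by
  simp [angle, sgn_zero, theta_zero]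

theorem angle_neg_zero (q : Chart n) : q.angle (neg 0) = Real.pi := by
  simp [angle, sgn_zero, theta_zero]

/-- The sign picks the one of `p_k` and `-p_k` with argument in `[0, π)`. -/
theorem angle_sgn (q : Chart n) (k : Fin (n + 1)) : q.angle (k, q.sgn k) = q.theta k := by
  simp [angle]

theorem exp_angle_ne (q : Chart n) {i j : SignedIndex n} (h : i ≠ j) :
    Circle.exp (q.angle i) ≠ Circle.exp (q.angle j) := by
  intro e
  have := q.angle_nonneg i
  have := q.angle_nonneg j
  have := q.angle_lt i
  have := q.angle_lt j
  have := le_max_left (q.angle i) (q.angle j)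
  have := le_max_right (q.angle i) (q.angle j)
  have := max_lt (q.angle_lt i) (q.angle_lt j)
  -- the open interval of length `2π` with this left end contains both angles
  exact h (q.injective_angle (lift_unique (a := max (q.angle i) (q.angle j) / 2 - Real.pi)
    (by linarith) (by linarith) (by linarith) (by linarith) e))

theorem exp_angle_neg (q : Chart n) (k : Fin (n + 1)) :
    Circle.exp (q.angle (neg k)) = -Circle.exp (q.angle (pos k)) := by
  unfold angle
  cases q.sgn k <;> simp [circleExp_pi]

/-- The configuration with `p₀ = 1` and given angle coordinates. -/
def conf (q : Chart n) : OrbitConf n :=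
  ⟨fun k => Circle.exp (q.angle (pos k)), fun i j hij =>
    ⟨q.exp_angle_ne fun e => hij (congrArg Prod.fst e), by
      rw [← exp_angle_neg]
      exact q.exp_angle_ne fun e => hij (congrArg Prod.fst e)⟩⟩

theorem point_conf (q : Chart n) (i : SignedIndex n) : q.conf.point i = Circle.exp (q.angle i) := by
  obtain ⟨k, _ | _⟩ := i
  · rfl
  · exact (q.exp_angle_neg k).symm

theorem continuous_conf : Continuous (conf (n := n)) := by
  refine Continuous.subtype_mk (continuous_pi fun k => Circle.exp.continuous.comp ?_) _
  exact (continuous_theta k).add ((continuous_of_discreteTopology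
    (f := fun s : Bool => if (s ^^ false) = true then Real.pi else 0)).comp (continuous_sgn k))

/-- The class in `Y n` of the configuration with given angle coordinates. -/
def toY (q : Chart n) : Y n := Quotient.mk _ q.conf

theorem continuous_toY : Continuous (toY (n := n)) := continuous_quotient_mk'.comp continuous_conf

open Classical in
/-- Since `p₀` has argument `0`, the linear order cut out at the index `0` is the order of the
arguments in `[0, 2π)`. -/
theorem cut_solution_toY (q : Chart n) {a b : SignedIndex n} (ha : pos 0 ≠ a) (hb : pos 0 ≠ b)
    (hab : a ≠ b) : (solution q.toY).cut a b = if q.angle a < q.angle b then 1 else 0 := by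
  have h (c : SignedIndex n) (hc : pos 0 ≠ c) : 0 < q.angle c :=
    lt_of_le_of_ne (q.angle_nonneg c) fun e => hc (q.injective_angle (by rw [angle_pos_zero, ← e]))
  rw [cut_solution _ ha hb hab]
  change (if IsCCW (q.conf.point (pos 0)) (q.conf.point a) (q.conf.point b) then (1 : ℤ) else 0) = _
  simp only [point_conf, angle_pos_zero]
  have ha' := q.angle_lt a
  have hb' := q.angle_lt b
  simp only [isCCW_exp_iff_of_lt (h a ha) (h b hb) (fun e => hab (q.injective_angle e))
    (by linarith) (by linarith)]

theorem angle_lt_iff_of_solution_eq {q q' : Chart n} (h : solution q.toY = solution q'.toY)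
    {a b : SignedIndex n} (ha : pos 0 ≠ a) (hb : pos 0 ≠ b) :
    q.angle a < q.angle b ↔ q'.angle a < q'.angle b := by
  by_cases hab : a = b
  · simp [hab]
  have h1 := q.cut_solution_toY ha hb hab
  rw [h, q'.cut_solution_toY ha hb hab] at h1
  split_ifs at h1 with h2 h3 h3
  · exact iff_of_true h3 h2
  · exact absurd h1 one_ne_zero
  · exact absurd h1 zero_ne_one
  · exact iff_of_false h3 h2

theorem sgn_eq_true_iff (q : Chart n) {k : Fin (n + 1)} (hk : k ≠ 0) :
    q.sgn k = true ↔ q.angle (neg 0) < q.angle (pos k) := by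
  have h1 := q.theta_pos hk
  have h2 := q.theta_lt_pi k
  rw [angle_neg_zero]
  unfold angle
  cases q.sgn k
  · simpa using h2.le
  · simpa using h1

/-- The signed cyclic order determines the signs. -/
theorem sgn_eq_of_solution_eq {q q' : Chart n} (h : solution q.toY = solution q'.toY)
    (k : Fin (n + 1)) : q.sgn k = q'.sgn k := by
  by_cases hk : k = 0
  · rw [hk, sgn_zero, sgn_zero]
  · rw [Bool.eq_iff_iff, sgn_eq_true_iff q hk, sgn_eq_true_iff q' hk]
    exact angle_lt_iff_of_solution_eq h (pos_zero_ne_neg 0) (pos_zero_ne hk)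

/-- The signed cyclic order determines the order of the angles. -/
theorem theta_lt_iff_of_solution_eq {q q' : Chart n} (h : solution q.toY = solution q'.toY)
    (j k : Fin (n + 1)) : q.theta j < q.theta k ↔ q'.theta j < q'.theta k := by
  by_cases hk : k = 0
  · simp only [hk, theta_zero, not_lt.2 (theta_nonneg _ _)]
  by_cases hj : j = 0
  · simp only [hj, theta_zero, theta_pos _ hk]
  · have := angle_lt_iff_of_solution_eq h (a := (j, q.sgn j)) (b := (k, q.sgn k)) (pos_zero_ne hj)
      (pos_zero_ne hk)
    rw [angle_sgn, angle_sgn] at this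
    rw [this, sgn_eq_of_solution_eq h j, sgn_eq_of_solution_eq h k, angle_sgn, angle_sgn]

/-! ### The contraction of the components -/

open Classical in
/-- The number of angles less than `θ_k`. -/
def thetaRank (q : Chart n) (k : Fin (n + 1)) : ℕ :=
  (Finset.univ.filter fun j => q.theta j < q.theta k).card

theorem thetaRank_lt_thetaRank (q : Chart n) {j k : Fin (n + 1)} (h : q.theta j < q.theta k) :
    q.thetaRank j < q.thetaRank k := by
  classical
  refine Finset.card_lt_card (Finset.ssubset_iff_of_subset (fun l hl => ?_) |>.2 ⟨j, ?_, ?_⟩)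
  · simp only [Finset.mem_filter, Finset.mem_univ, true_and] at hl ⊢
    exact hl.trans h
  · simpa using h
  · simp

theorem thetaRank_zero (q : Chart n) : q.thetaRank 0 = 0 := by
  classical
  rw [thetaRank, Finset.card_eq_zero, Finset.filter_eq_empty_iff]
  intro j _
  rw [theta_zero]
  exact not_lt.2 (q.theta_nonneg j)

theorem thetaRank_lt (q : Chart n) (k : Fin (n + 1)) : q.thetaRank k < n + 1 := by
  classical
  have : (Finset.univ.filter fun j => q.theta j < q.theta k) ⊂ Finset.univ :=
    Finset.filter_ssubset.2 ⟨k, Finset.mem_univ k, lt_irrefl _⟩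
  simpa [thetaRank] using Finset.card_lt_card this

theorem isLocallyConstant_theta_lt (j k : Fin (n + 1)) :
    IsLocallyConstant fun q : Chart n => q.theta j < q.theta k := by
  rcases eq_or_ne j k with rfl | hjk
  · simp only [lt_irrefl]
    exact IsLocallyConstant.const False
  · rw [IsLocallyConstant.iff_exists_open]
    intro q
    by_cases h : q.theta j < q.theta k
    · exact ⟨_, isOpen_lt (continuous_theta j) (continuous_theta k), h,
        fun q' (h' : q'.theta j < q'.theta k) => by simp [h, h']⟩
    · refine ⟨_, isOpen_lt (continuous_theta k) (continuous_theta j), lt_of_le_of_ne (not_lt.1 h)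
        fun e => hjk (q.injective_theta e).symm, fun q' (h' : q'.theta k < q'.theta j) => ?_⟩
      simp [h, h'.not_gt]

theorem isLocallyConstant_thetaRank (k : Fin (n + 1)) :
    IsLocallyConstant fun q : Chart n => q.thetaRank k := by
  classical
  rw [IsLocallyConstant.iff_eventually_eq]
  intro q
  have : ∀ᶠ q' in nhds q, ∀ j, (q'.theta j < q'.theta k) = (q.theta j < q.theta k) :=
    Filter.eventually_all.2 fun j => (isLocallyConstant_theta_lt j k).eventually_eq q
  refine this.mono fun q' h => ?_
  unfold thetaRank
  simp only [h]

/-- The straight line contraction: at time `s` the angles lie at `s θ_k + (1 - s) π ρ_k / (n + 1)`,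
where `ρ_k` is the rank of `θ_k`, so that their order does not change. -/
def contract (x : unitInterval × Chart n) : Chart n :=
  ⟨(x.2.sgn, fun k => (x.1 : ℝ) * x.2.theta k +
    (1 - x.1) * (Real.pi * x.2.thetaRank k / (n + 1))), by
    obtain ⟨⟨s, hs0, hs1⟩, q⟩ := x
    have hn : (0 : ℝ) < n + 1 := by positivity
    have hlt {j k} (h : q.theta j < q.theta k) :
        s * q.theta j + (1 - s) * (Real.pi * q.thetaRank j / (n + 1)) <
        s * q.theta k + (1 - s) * (Real.pi * q.thetaRank k / (n + 1)) := by
      have h2 : (q.thetaRank j : ℝ) < q.thetaRank k := by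
        exact_mod_cast q.thetaRank_lt_thetaRank h
      have h3 : Real.pi * q.thetaRank j / (n + 1) < Real.pi * q.thetaRank k / (n + 1) := by
        gcongr
      rcases hs0.eq_or_lt with rfl | hs
      · simpa using h3
      · exact add_lt_add_of_lt_of_le (mul_lt_mul_of_pos_left h hs)
          (mul_le_mul_of_nonneg_left h3.le (by linarith))
    refine ⟨q.sgn_zero, by simp [theta_zero, thetaRank_zero], fun k => ⟨?_, ?_⟩, fun j k h => ?_⟩
    · have := q.theta_nonneg k
      have : 0 ≤ 1 - s := by linarith
      have := Real.pi_pos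
      dsimp only
      positivity
    · have h1 := q.theta_lt_pi k
      have h2 : Real.pi * q.thetaRank k / (n + 1) < Real.pi := by
        rw [div_lt_iff₀ hn]
        have : (q.thetaRank k : ℝ) < n + 1 := by exact_mod_cast q.thetaRank_lt k
        exact mul_lt_mul_of_pos_left this Real.pi_pos
      have := convex_Iio Real.pi h1 h2 hs0 (by linarith : 0 ≤ 1 - s) (by ring)
      simpa using this
    · rcases lt_trichotomy (q.theta j) (q.theta k) with h1 | h1 | h1
      · exact absurd h (hlt h1).ne
      · exact q.injective_theta h1
      · exact absurd h (hlt h1).ne'⟩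

theorem continuous_contract : Continuous (contract (n := n)) := by
  have h1 : Continuous fun x : unitInterval × Chart n => (x.1 : ℝ) :=
    continuous_subtype_val.comp continuous_fst
  refine Continuous.subtype_mk (Continuous.prodMk ?_ ?_) _
  · exact continuous_pi fun k => (continuous_sgn k).comp continuous_snd
  · refine continuous_pi fun k => (h1.mul ((continuous_theta k).comp continuous_snd)).add
      ((continuous_const.sub h1).mul ((continuous_const.mul ?_).div_const _))
    exact ((isLocallyConstant_thetaRank k).comp fun r : ℕ => (r : ℝ)).continuous.comp continuous_snd

theorem contract_one (q : Chart n) : contract (1, q) = q :=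
  ext' (fun _ => rfl) fun k => by simp [contract, theta]

theorem contract_zero_eq {q q' : Chart n} (h : ∀ k, q.sgn k = q'.sgn k)
    (h' : ∀ k, q.thetaRank k = q'.thetaRank k) : contract (0, q) = contract (0, q') :=
  ext' h fun k => by simp [contract, theta, h']

theorem isLocallyConstant_contract_zero :
    IsLocallyConstant fun q : Chart n => contract (0, q) := by
  rw [IsLocallyConstant.iff_eventually_eq]
  intro q
  have h1 : ∀ᶠ q' in nhds q, ∀ k, q'.sgn k = q.sgn k := Filter.eventually_all.2 fun k =>
    ((IsLocallyConstant.iff_continuous _).2 (continuous_sgn k)).eventually_eq q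
  have h2 : ∀ᶠ q' in nhds q, ∀ k, q'.thetaRank k = q.thetaRank k :=
    Filter.eventually_all.2 fun k => (isLocallyConstant_thetaRank k).eventually_eq q
  filter_upwards [h1, h2] with q' h1 h2 using contract_zero_eq h1 h2

theorem contract_zero_eq_of_solution_eq {q q' : Chart n}
    (h : solution q.toY = solution q'.toY) : contract (0, q) = contract (0, q') := by
  classical
  refine contract_zero_eq (sgn_eq_of_solution_eq h) fun k => ?_
  unfold thetaRank
  simp only [theta_lt_iff_of_solution_eq h]

end Chart

variable {n : ℕ}

/-! ### Angle coordinates of a configuration -/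

/-- The rotated point `p_k / p_0`. -/
def rotated (p : OrbitConf n) (k : Fin (n + 1)) : Circle := (p.1 0)⁻¹ * p.1 k

theorem rotated_smul (g : Circle) (p : OrbitConf n) (k : Fin (n + 1)) :
    rotated (g • p) k = rotated p k := by
  change (g * p.1 0)⁻¹ * (g * p.1 k) = (p.1 0)⁻¹ * p.1 k
  group

theorem rotated_zero (p : OrbitConf n) : rotated p 0 = 1 := inv_mul_cancel _

theorem rotated_ne (p : OrbitConf n) {j k : Fin (n + 1)} (h : j ≠ k) :
    rotated p j ≠ rotated p k ∧ rotated p j ≠ -rotated p k := by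
  refine ⟨fun e => (p.2 j k h).1 (mul_left_cancel e), fun e => (p.2 j k h).2 ?_⟩
  exact mul_left_cancel (e.trans (mul_neg _ _).symm)

theorem continuous_rotated (k : Fin (n + 1)) : Continuous fun p : OrbitConf n => rotated p k := by
  have h (k : Fin (n + 1)) : Continuous fun p : OrbitConf n => p.1 k :=
    (continuous_apply k).comp continuous_subtype_val
  exact (h 0).inv.mul (h k)

open Classical in
/-- The sign of a point of the circle: `true` on the open lower half circle. -/
def circleSign (z : Circle) : Bool := decide ((z : ℂ).im < 0)

/-- The angle in `[0, π]` between the positive real axis and the one of `z`, `-z` that is not in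
the open lower half plane. -/
def circleAngle (z : Circle) : ℝ :=
  Real.arccos ((if circleSign z = true then -1 else 1) * (z : ℂ).re)

theorem exp_arccos_re {z : Circle} (hz : 0 ≤ (z : ℂ).im) :
    Circle.exp (Real.arccos (z : ℂ).re) = z := by
  have h : Complex.arg z = Real.arccos (z : ℂ).re := by
    rw [Complex.arg_of_im_nonneg_of_ne_zero hz z.coe_ne_zero, Circle.norm_coe, div_one]
  rw [← h, Circle.exp_arg]

theorem exp_circleAngle (z : Circle) :
    Circle.exp (circleAngle z + if circleSign z = true then Real.pi else 0) = z := by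
  unfold circleAngle
  by_cases h : (z : ℂ).im < 0
  · have hs : circleSign z = true := by simpa [circleSign] using h
    have hz : 0 ≤ ((-z : Circle) : ℂ).im := by
      change 0 ≤ (-(z : ℂ)).im
      rw [Complex.neg_im]
      linarith
    have := exp_arccos_re hz
    rw [if_pos hs, if_pos hs, Circle.exp_add, circleExp_pi, neg_one_mul, ← Complex.neg_re]
    change Circle.exp (Real.arccos ((-z : Circle) : ℂ).re) * -1 = z
    rw [this, mul_neg_one, neg_neg]
  · have hs : ¬circleSign z = true := by simpa [circleSign] using h
    rw [if_neg hs, if_neg hs, one_mul, add_zero, exp_arccos_re (not_lt.1 h)]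

theorem exp_circleAngle_or (z : Circle) :
    Circle.exp (circleAngle z) = z ∨ Circle.exp (circleAngle z) = -z := by
  have := exp_circleAngle z
  split_ifs at this
  · right
    rw [Circle.exp_add, circleExp_pi, mul_neg_one] at this
    exact neg_eq_iff_eq_neg.1 this
  · left
    rwa [add_zero] at this

theorem circleSign_one : circleSign 1 = false := by simp [circleSign]

theorem circleAngle_one : circleAngle 1 = 0 := by simp [circleAngle, circleSign_one]

theorem eq_of_circleAngle_rotated_eq (p : OrbitConf n) {j k : Fin (n + 1)}
    (h : circleAngle (rotated p j) = circleAngle (rotated p k)) : j = k := by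
  by_contra hjk
  obtain ⟨h1, h2⟩ := rotated_ne p hjk
  have h3 := exp_circleAngle_or (rotated p j)
  rw [h] at h3
  rcases h3 with h3 | h3 <;> rcases exp_circleAngle_or (rotated p k) with h4 | h4
  · exact h1 (h3.symm.trans h4)
  · exact h2 (h3.symm.trans h4)
  · exact h2 (by rw [← h4, h3, neg_neg])
  · exact h1 (neg_injective (h3.symm.trans h4))

theorem circleAngle_rotated_lt_pi (p : OrbitConf n) (k : Fin (n + 1)) :
    circleAngle (rotated p k) < Real.pi := by
  refine lt_of_le_of_ne (Real.arccos_le_pi _) fun e => ?_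
  have hk : k ≠ 0 := by
    rintro rfl
    rw [rotated_zero, circleAngle_one] at e
    exact Real.pi_ne_zero e.symm
  obtain ⟨h1, h2⟩ := rotated_ne p hk
  rw [rotated_zero] at h1 h2
  rcases exp_circleAngle_or (rotated p k) with h | h <;> rw [e, circleExp_pi] at h
  · exact h2 h.symm
  · exact h1 (neg_injective h).symm

/-- For `k ≠ 0` the point `p_k / p_0` avoids `±1`, where the sign jumps. -/
theorem continuous_circleSign_rotated (k : Fin (n + 1)) :
    Continuous fun p : OrbitConf n => circleSign (rotated p k) := by
  rcases eq_or_ne k 0 with rfl | hk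
  · simp only [rotated_zero]
    exact continuous_const
  have him : Continuous fun p : OrbitConf n => (rotated p k : ℂ).im :=
    Complex.continuous_im.comp (continuous_subtype_val.comp (continuous_rotated k))
  have hne (p : OrbitConf n) : (rotated p k : ℂ).im ≠ 0 := by
    intro h
    obtain ⟨h1, h2⟩ := rotated_ne p hk
    rw [rotated_zero] at h1 h2
    have hsq := Circle.normSq_coe (rotated p k)
    rw [Complex.normSq_apply, h, mul_zero, add_zero, mul_self_eq_one_iff] at hsq
    rcases hsq with hsq | hsq
    · exact h1 (Circle.ext (Complex.ext hsq h))
    · refine h2 (Circle.ext (Complex.ext hsq (h.trans ?_)))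
      change 0 = (-(1 : ℂ)).im
      simp
  rw [continuous_bool_rng true]
  have h1 : (fun p : OrbitConf n => circleSign (rotated p k)) ⁻¹' {true} =
      {p | (rotated p k : ℂ).im < 0} := by
    ext p
    simp [circleSign]
  have h2 : {p : OrbitConf n | (rotated p k : ℂ).im < 0} = {p | (rotated p k : ℂ).im ≤ 0} := by
    ext p
    exact ⟨fun h => le_of_lt (Set.mem_ofPred_eq.mp h), fun h => lt_of_le_of_ne h (hne p)⟩
  rw [h1]
  refine ⟨?_, isOpen_lt him continuous_const⟩
  rw [h2]
  exact isClosed_le him continuous_const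

theorem continuous_circleAngle_rotated (k : Fin (n + 1)) :
    Continuous fun p : OrbitConf n => circleAngle (rotated p k) := by
  refine Real.continuous_arccos.comp (Continuous.mul ?_ ?_)
  · exact (continuous_of_discreteTopology
      (f := fun s : Bool => if s = true then (-1 : ℝ) else 1)).comp
      (continuous_circleSign_rotated k)
  · exact Complex.continuous_re.comp (continuous_subtype_val.comp (continuous_rotated k))

/-- The angle coordinates of a configuration. -/
def chartOfConf (p : OrbitConf n) : Chart n :=
  ⟨(fun k => circleSign (rotated p k), fun k => circleAngle (rotated p k)),
    by simp only [rotated_zero, circleSign_one], by simp only [rotated_zero, circleAngle_one],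
    fun k => ⟨Real.arccos_nonneg _, circleAngle_rotated_lt_pi p k⟩,
    fun _ _ h => eq_of_circleAngle_rotated_eq p h⟩

theorem continuous_chartOfConf : Continuous (chartOfConf (n := n)) :=
  Continuous.subtype_mk ((continuous_pi continuous_circleSign_rotated).prodMk
    (continuous_pi continuous_circleAngle_rotated)) _

/-- The angle coordinates on `Y n`. -/
def toChart : Y n → Chart n :=
  Quotient.lift chartOfConf (by
    rintro _ p ⟨g, rfl⟩
    exact Chart.ext' (fun k => congrArg circleSign (rotated_smul g p k))
      fun k => congrArg circleAngle (rotated_smul g p k))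

theorem continuous_toChart : Continuous (toChart (n := n)) :=
  continuous_chartOfConf.quotient_lift _

theorem toY_toChart (z : Y n) : (toChart z).toY = z := by
  induction z using Quotient.inductionOn with
  | h p =>
  refine Quotient.sound ⟨(p.1 0)⁻¹, Subtype.ext (funext fun k => ?_)⟩
  change rotated p k = Circle.exp ((chartOfConf p).angle (pos k))
  conv_lhs => rw [← exp_circleAngle (rotated p k)]
  simp [Chart.angle, chartOfConf, Chart.theta, Chart.sgn]

/-- The homotopy contracting every component of `Y n` to a point. -/
def contraction (x : unitInterval × Y n) : Y n := (Chart.contract (x.1, toChart x.2)).toY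

theorem continuous_contraction : Continuous (contraction (n := n)) :=
  Chart.continuous_toY.comp (Chart.continuous_contract.comp
    (continuous_fst.prodMk (continuous_toChart.comp continuous_snd)))

theorem contraction_one (z : Y n) : contraction (1, z) = z := by
  rw [contraction, Chart.contract_one, toY_toChart]

theorem isLocallyConstant_contraction_zero :
    IsLocallyConstant fun z : Y n => contraction (0, z) :=
  (Chart.isLocallyConstant_contract_zero.comp Chart.toY).comp_continuous continuous_toChart

/-- Two configurations with the same signed cyclic order lie in the same component, so that every
locally constant function takes the same value at both. -/
theorem eq_of_solution_eq {A : Type*} {f : Y n → A} (hf : IsLocallyConstant f) {z z' : Y n}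
    (h : solution z = solution z') : f z = f z' := by
  have key (z : Y n) : f z = f (contraction (0, z)) := by
    have hc : IsLocallyConstant fun s : unitInterval => f (contraction (s, z)) :=
      hf.comp_continuous (continuous_contraction.comp (continuous_id.prodMk continuous_const))
    have := hc.apply_eq_of_preconnectedSpace 1 0
    rwa [contraction_one] at this
  rw [key z, key z', contraction, contraction, Chart.contract_zero_eq_of_solution_eq]
  rwa [toY_toChart, toY_toChart]

/-! ### Counting components -/

/-- Angle coordinates with given signs and with equally spaced angles in the order given by a
permutation. -/
def chartOfPerm (e : Fin n → Bool) (σ : Equiv.Perm (Fin n)) : Chart n :=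
  ⟨(Fin.cons false e, Fin.cons 0 fun k => Real.pi * ((σ k : ℝ) + 1) / (n + 1)), rfl, rfl, by
    have hn : (0 : ℝ) < n + 1 := by positivity
    have hpi := Real.pi_pos
    refine Fin.cases ⟨le_rfl, hpi⟩ fun k => ⟨?_, ?_⟩
    · simp only [Fin.cons_succ]
      positivity
    · simp only [Fin.cons_succ]
      rw [div_lt_iff₀ hn]
      have : ((σ k : ℕ) : ℝ) < n := by exact_mod_cast (σ k).2
      exact mul_lt_mul_of_pos_left (by linarith) hpi, by
    have hn : (0 : ℝ) < n + 1 := by positivity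
    refine Fin.cons_injective_iff.2 ⟨?_, fun j k h => ?_⟩
    · rintro ⟨k, hk⟩
      have : 0 < Real.pi * ((σ k : ℝ) + 1) / (n + 1) := by positivity
      exact this.ne' hk
    · have h1 : Real.pi * ((σ j : ℝ) + 1) / (n + 1) = Real.pi * ((σ k : ℝ) + 1) / (n + 1) := h
      rw [div_left_inj' hn.ne', mul_right_inj' Real.pi_ne_zero, add_left_inj, Nat.cast_inj] at h1
      exact σ.injective (Fin.ext h1)⟩

theorem theta_chartOfPerm_lt_iff (e : Fin n → Bool) (σ : Equiv.Perm (Fin n)) (j k : Fin n) :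
    (chartOfPerm e σ).theta j.succ < (chartOfPerm e σ).theta k.succ ↔ σ j < σ k := by
  have hn : (0 : ℝ) < n + 1 := by positivity
  change Real.pi * ((σ j : ℝ) + 1) / (n + 1) < Real.pi * ((σ k : ℝ) + 1) / (n + 1) ↔ _
  rw [div_lt_div_iff_of_pos_right hn, mul_lt_mul_iff_right₀ Real.pi_pos, add_lt_add_iff_right,
    Nat.cast_lt, Fin.lt_def]

theorem injective_solution_chartOfPerm :
    Function.Injective fun x : (Fin n → Bool) × Equiv.Perm (Fin n) =>
      solution (chartOfPerm x.1 x.2).toY := by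
  rintro ⟨e, σ⟩ ⟨e', σ'⟩ h
  dsimp only at h
  refine Prod.ext (funext fun k => Chart.sgn_eq_of_solution_eq h k.succ) ?_
  have hlt (j k : Fin n) : σ j < σ k ↔ σ' j < σ' k := by
    have := Chart.theta_lt_iff_of_solution_eq h j.succ k.succ
    rwa [theta_chartOfPerm_lt_iff, theta_chartOfPerm_lt_iff] at this
  -- `σ' ∘ σ⁻¹` is an order automorphism of `Fin n`, hence trivial
  let o : Fin n ≃o Fin n :=
    { toEquiv := σ.symm.trans σ'
      map_rel_iff' := fun {a b} => by
        have := hlt (σ.symm b) (σ.symm a)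
        simp only [Equiv.apply_symm_apply] at this
        simpa using (not_congr this).symm }
  have ho : o = OrderIso.refl _ := Subsingleton.elim _ _
  refine Equiv.ext fun k => ?_
  have := DFunLike.congr_fun ho (σ k)
  simpa [o] using this.symm

theorem card_le_natCard_solutionSet (n : ℕ) : 2 ^ n * n.factorial ≤ Nat.card (SolutionSet n) := by
  have := Nat.card_le_card_of_injective _ (injective_solution_chartOfPerm (n := n))
  simpa [Nat.card_eq_fintype_card, Fintype.card_perm] using this

namespace SolutionSet

/-- The products of fingers are linearly independent as functions: they span, and there are no
more of them than solutions. -/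
theorem linearIndependent_fingerMonomial :
    LinearIndependent ℤ fun c => (ev (fingerMonomial (n := n) c)) := by
  have := Fintype.ofFinite (SolutionSet n)
  refine linearIndependent_of_top_le_span_of_card_le_finrank span_fingerMonomial.ge ?_
  rw [card_fingers, Module.finrank_fintype_fun_eq_card, ← Nat.card_eq_fintype_card]
  exact card_le_natCard_solutionSet n

theorem natCard_eq : Nat.card (SolutionSet n) = 2 ^ n * n.factorial := by
  have := Fintype.ofFinite (SolutionSet n)
  refine le_antisymm ?_ (card_le_natCard_solutionSet n)
  have := Module.finrank_eq_card_basis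
    (Module.Basis.mk (linearIndependent_fingerMonomial (n := n)) span_fingerMonomial.ge)
  rw [card_fingers, Module.finrank_fintype_fun_eq_card, ← Nat.card_eq_fintype_card] at this
  exact this.le

end SolutionSet

/-- The representatives `chartOfPerm` meet every signed cyclic order exactly once, since injectivity
and the count of the spanning monomials leave no room for more solutions. -/
theorem bijective_solution_chartOfPerm :
    Function.Bijective fun x : (Fin n → Bool) × Equiv.Perm (Fin n) =>
      solution (chartOfPerm x.1 x.2).toY := by
  refine (Nat.bijective_iff_injective_and_card _).2 ⟨injective_solution_chartOfPerm, ?_⟩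
  rw [SolutionSet.natCard_eq]
  simp [Nat.card_eq_fintype_card, Fintype.card_perm]

/-- Every solution of the relations is the signed cyclic order of a configuration. -/
theorem surjective_solution : Function.Surjective (solution (n := n)) := fun w => by
  obtain ⟨x, hx⟩ := bijective_solution_chartOfPerm.2 w
  exact ⟨_, hx⟩

theorem isLocallyConstant_solution : IsLocallyConstant (solution (n := n)) := by
  rw [IsLocallyConstant.iff_eventually_eq]
  intro z
  have : ∀ᶠ z' in nhds z, ∀ t : Triple n, (solution z').1 t = (solution z).1 t :=
    Filter.eventually_all.2 fun t =>
      (isLocallyConstant_heavisideFun t.2.1 t.2.2.1 t.2.2.2).eventually_eq z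
  exact this.mono fun z' h => SolutionSet.ext_triple h

/-! ### The presentation and the basis -/

/-- The quotient by the relations is the ring of integral functions on their solutions. -/
def quotientEquiv (n : ℕ) : (HeavisidePoly n ⧸ relationIdeal n) ≃+* (SolutionSet n → ℤ) :=
  (Ideal.quotEquivOfEq (Ideal.ext fun P => (SolutionSet.mem_relationIdeal_iff P).trans
    (RingHom.mem_ker (f := SolutionSet.ev)).symm)).trans
  (RingHom.quotientKerEquivOfSurjective (f := SolutionSet.ev (n := n)) fun f => by
    have hf : f ∈ Submodule.span ℤ (Set.range fun c => SolutionSet.ev (fingerMonomial c)) := by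
      rw [SolutionSet.span_fingerMonomial]
      trivial
    induction hf using Submodule.span_induction with
    | mem f hf =>
      obtain ⟨c, rfl⟩ := hf
      exact ⟨_, rfl⟩
    | zero => exact ⟨0, map_zero _⟩
    | add f g _ _ hf hg =>
      obtain ⟨P, rfl⟩ := hf
      obtain ⟨Q, rfl⟩ := hg
      exact ⟨P + Q, map_add _ _ _⟩
    | smul z f _ hf =>
      obtain ⟨P, rfl⟩ := hf
      exact ⟨z • P, map_zsmul _ _ _⟩)

theorem quotientEquiv_mk (P : HeavisidePoly n) :
    quotientEquiv n (Ideal.Quotient.mk _ P) = SolutionSet.ev P := rfl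

/-- The components of `Y n` correspond to the solutions of the relations. -/
def locallyConstantEquiv (n : ℕ) : (SolutionSet n → ℤ) ≃+* LocallyConstant (Y n) ℤ :=
  RingEquiv.ofBijective (S := LocallyConstant (Y n) ℤ) (R := SolutionSet n → ℤ) (F := _ →+* _)
    { toFun := fun f => ⟨fun z => f (solution z), isLocallyConstant_solution.comp f⟩
      map_one' := rfl
      map_mul' := fun _ _ => rfl
      map_zero' := rfl
      map_add' := fun _ _ => rfl }
    ⟨fun f g h => funext fun w => by
      obtain ⟨z, rfl⟩ := surjective_solution w
      exact LocallyConstant.congr_fun h z, fun f => by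
      refine ⟨fun w => f (surjective_solution w).choose, LocallyConstant.ext fun z => ?_⟩
      exact eq_of_solution_eq f.isLocallyConstant (surjective_solution (solution z)).choose_spec⟩

/-- The cohomology of `Y n` is the ring of integral functions on the solutions. -/
def cohomologyEquiv (n : ℕ) : (SolutionSet n → ℤ) ≃+* SingularCohomology ℤ (Y n) :=
  (locallyConstantEquiv n).trans (SingularCohomology.equivOfContraction continuous_contraction
    isLocallyConstant_contraction_zero contraction_one)

/-- The hand monomials form a basis of the functions on the solutions. -/
def handBasis (n : ℕ) : Module.Basis (handMonomials n) ℤ (SolutionSet n → ℤ) :=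
  Module.Basis.mk (v := fun m : handMonomials n => SolutionSet.ev (m : HeavisidePoly n))
    (by
      -- choosing labels restricts the independent family of all labels to the set of monomials
      choose c hc using fun m : handMonomials n => (range_fingerMonomial n).superset m.2
      have hinj : Function.Injective c := fun m m' h => Subtype.ext (by rw [← hc m, h, hc m'])
      have := SolutionSet.linearIndependent_fingerMonomial.comp c hinj
      simpa only [Function.comp_def, hc] using this)
    (by
      rw [← SolutionSet.span_fingerMonomial]
      refine Submodule.span_mono ?_
      rintro _ ⟨c, rfl⟩
      exact ⟨⟨_, (range_fingerMonomial n).subset ⟨c, rfl⟩⟩, rfl⟩)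

end TypeB

end

theorem mainTheorem4 (n : ℕ) :
    ∃ Φ : (TypeB.HeavisidePoly n ⧸ TypeB.relationIdeal n) ≃+*
        SingularCohomology ℤ (TypeB.Y n),
      (∀ (i j k : TypeB.SignedIndex n) (hij : i ≠ j) (hik : i ≠ k) (hjk : j ≠ k),
        Φ (Ideal.Quotient.mk (TypeB.relationIdeal n) (TypeB.y i j k hij hik hjk)) =
          TypeB.heaviside i j k hij hik hjk) ∧
      ∃ b : Module.Basis (TypeB.handMonomials n) ℤ (SingularCohomology ℤ (TypeB.Y n)),
        ∀ m : TypeB.handMonomials n,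
          b m = Φ (Ideal.Quotient.mk (TypeB.relationIdeal n) m) := by
  refine ⟨(TypeB.quotientEquiv n).trans (TypeB.cohomologyEquiv n), fun i j k hij hik hjk => ?_,
    (TypeB.handBasis n).map (TypeB.cohomologyEquiv n).toAddEquiv.toIntLinearEquiv, fun m => ?_⟩
  · rw [RingEquiv.trans_apply, TypeB.quotientEquiv_mk]
    refine congrArg SingularCohomology.ofLocallyConstant (LocallyConstant.ext fun z => ?_)
    exact MvPolynomial.eval_X (f := (TypeB.solution z).1) _
  · rw [Module.Basis.map_apply, TypeB.handBasis, Module.Basis.mk_apply, RingEquiv.trans_apply,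
      TypeB.quotientEquiv_mk]
    rfl
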